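/- Let $\Bbbk$ be a field and let $R=\bigoplus_{i\ge 0}R_i$ be an $\mathbb N$-graded, finitely generated $\Bbbk$-algebra with $R_0=\Bbbk$. Assume that $R$ is an integral domain, and let $R^{(1)}=\Bbbk[R_1]\subseteq R$ be the subalgebra generated by the elements of degree $1$, with the induced grading. Assume that $R$ is \emph{semistandard}, i.e. integral over $R^{(1)}$. For a graded ring $A$ that is either $R$ or $R^{(1)}$, let the multiplicity of $A$ be the integer $e(A)=Q_A(1)$, where $\sum_{i\ge0}\dim_\Bbbk(A_i)\,t^i=Q_A(t)/(1-t)^{\dim A}$ with $Q_A\in\mathbb Z[t]$ and $\dim A$ the Krull dimension. Call $R$ \emph{virtually standard} if it is semistandard and $e(R)=e(R^{(1)})$. A morphism of schemes is \emph{birational} if it restricts to an isomorphism from a dense open subscheme of the source onto a dense open subscheme of the target. Then the following are equivalent: (a) $R$ is virtually standard; (b) $R$ has rank $1$ as an $R^{(1)}$-module, i.e. $\dim_{\mathrm{Quot}(R^{(1)})}\bigl(R\otimes_{R^{(1)}}\mathrm{Quot}(R^{(1)})\bigr)=1$; (c) the natural inclusion of fraction fields $\mathrm{Quot}(R^{(1)})\hookrightarrow\mathrm{Quot}(R)$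 is an isomorphism; (d) the natural projection $\mathrm{Spec}\,R\to\mathrm{Spec}\,R^{(1)}$ is birational; (e) the morphism $\mathrm{Proj}\,R\to\mathrm{Proj}\,R^{(1)}$ induced by the inclusion $R^{(1)}\subseteq R$ is birational. -/

import Mathlib

open AlgebraicGeometry CategoryTheory HomogeneousLocalization TensorProduct

universe v u

namespace VirtStd

section Graded

variable {k : Type v} {R : Type u} [Field k] [CommRing R] [Algebra k R]
variable (𝒜 : ℕ → Submodule k R)

/-- The subalgebra `R⁽¹⁾ = k[R₁]` of `R` generated by the elements of degree one. -/
abbrev degOne : Subalgebra k R := Algebra.adjoin k (𝒜 1 : Set R)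

/-- The induced grading of `R⁽¹⁾`, with `i`-th piece `R⁽¹⁾ ∩ Rᵢ`. -/
def degOneGrading (i : ℕ) : Submodule k (degOne 𝒜) :=
  (𝒜 i).comap (degOne 𝒜).val.toLinearMap

theorem mem_degOneGrading {i : ℕ} {x : degOne 𝒜} :
    x ∈ degOneGrading 𝒜 i ↔ (x : R) ∈ 𝒜 i := Iff.rfl

variable [GradedAlgebra 𝒜]

theorem decompose_mem_degOne (i : ℕ) {x : R} (hx : x ∈ degOne 𝒜) :
    (DirectSum.decompose 𝒜 x i : R) ∈ degOne 𝒜 := by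
  have h : DirectSum.SetLike.IsHomogeneous 𝒜
      (Subsemiring.closure (Set.range (algebraMap k R) ∪ (𝒜 1 : Set R))) := by
    apply IsHomogeneous.subsemiringClosure_of_isHomogeneousElem
    rintro y (⟨c, rfl⟩ | hy)
    · exact ⟨0, SetLike.algebraMap_mem_graded 𝒜 c⟩
    · exact ⟨1, hy⟩
  exact h i hx

instance : SetLike.GradedMonoid (degOneGrading 𝒜) where
  one_mem := SetLike.GradedOne.one_mem (A := 𝒜)
  mul_mem _ _ _ _ hx hy := SetLike.GradedMul.mul_mem (A := 𝒜) hx hy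

theorem decompose_coe_degOne (z : DirectSum ℕ fun i => degOneGrading 𝒜 i) (n : ℕ) :
    (DirectSum.decompose 𝒜
      ((DirectSum.coeAddMonoidHom (degOneGrading 𝒜) z : degOne 𝒜) : R) n : R) =
      ((z n : degOne 𝒜) : R) := by
  induction z using DirectSum.induction_on with
  | zero => simp
  | of i x =>
    rw [DirectSum.coeAddMonoidHom_of]
    by_cases h : i = n
    · subst h
      rw [DirectSum.decompose_of_mem_same 𝒜 ((mem_degOneGrading 𝒜).1 x.2), DirectSum.of_eq_same]
    · rw [DirectSum.decompose_of_mem_ne 𝒜 ((mem_degOneGrading 𝒜).1 x.2) h, DirectSum.of_eq_of_ne _ _ _ (Ne.symm h)]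
      rfl
  | add x y hx hy =>
    simp only [map_add, AddMemClass.coe_add, DirectSum.decompose_add, DirectSum.add_apply,
      hx, hy]

theorem degOneGrading_isInternal : DirectSum.IsInternal (degOneGrading 𝒜) := by
  classical
  constructor
  · intro x y hxy
    refine DFinsupp.ext fun n => Subtype.ext (Subtype.ext ?_)
    rw [← decompose_coe_degOne, ← decompose_coe_degOne, hxy]
  · intro x
    refine ⟨∑ i ∈ (DirectSum.decompose 𝒜 (x : R)).support,
      DirectSum.of (fun i => degOneGrading 𝒜 i) i
        ⟨⟨_, decompose_mem_degOne 𝒜 i x.2⟩, (DirectSum.decompose 𝒜 (x : R) i).2⟩, ?_⟩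
    refine Subtype.ext ?_
    rw [map_sum, AddSubmonoidClass.coe_finsetSum]
    simp only [DirectSum.coeAddMonoidHom_of]
    exact DirectSum.sum_support_decompose 𝒜 (x : R)

noncomputable instance : DirectSum.Decomposition (degOneGrading 𝒜) :=
  (degOneGrading_isInternal 𝒜).chooseDecomposition

noncomputable instance : GradedAlgebra (degOneGrading 𝒜) where

/-- The inclusion `R⁽¹⁾ → R` as a homomorphism of graded rings. -/
def degOneIncl : degOneGrading 𝒜 →+*ᵍ 𝒜 where
  toRingHom := algebraMap (degOne 𝒜) R
  map_mem h := h

end Graded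

section Multiplicity

variable {k : Type v} {A : Type u} [Field k] [CommRing A] [Algebra k A]

/-- The Hilbert series `∑ dim_k (Aᵢ) tⁱ`. -/
noncomputable def hilbertSeries (𝒜 : ℕ → Submodule k A) : PowerSeries ℤ :=
  PowerSeries.mk fun i => (Module.finrank k (𝒜 i) : ℤ)

/-- `A` has multiplicity `e`: its Hilbert series is `Q(t) / (1 - t) ^ d` for a polynomial `Q` with
integer coefficients and `Q(1) = e`, where `d` is the Krull dimension of `A`. -/
def HasMultiplicity (𝒜 : ℕ → Submodule k A) (e : ℤ) : Prop :=
  ∃ (d : ℕ) (Q : Polynomial ℤ), ringKrullDim A = d ∧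
    hilbertSeries 𝒜 * (1 - PowerSeries.X) ^ d = (Q : PowerSeries ℤ) ∧ Q.eval 1 = e

theorem HasMultiplicity.unique {𝒜 : ℕ → Submodule k A} {e e' : ℤ}
    (h : HasMultiplicity 𝒜 e) (h' : HasMultiplicity 𝒜 e') : e = e' := by
  obtain ⟨d, Q, hd, hQ, rfl⟩ := h
  obtain ⟨d', Q', hd', hQ', rfl⟩ := h'
  obtain rfl : d = d' := by
    have := hd.symm.trans hd'
    exact_mod_cast this
  rw [Polynomial.coe_injective ℤ (hQ.symm.trans hQ')]

/-- `R` is semistandard if it is integral over `R⁽¹⁾`. -/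
def IsSemistandard (𝒜 : ℕ → Submodule k A) : Prop := Algebra.IsIntegral (degOne 𝒜) A

/-- `R` is virtually standard if it is semistandard and has the same multiplicity as `R⁽¹⁾`. -/
def IsVirtuallyStandard (𝒜 : ℕ → Submodule k A) : Prop :=
  IsSemistandard 𝒜 ∧ ∃ e : ℤ, HasMultiplicity 𝒜 e ∧ HasMultiplicity (degOneGrading 𝒜) e

end Multiplicity

/-- The rank of a module `M` over a domain `S`: the dimension of `Quot(S) ⊗ M` over `Quot(S)`. -/
noncomputable def rankOverDomain (S M : Type*) [CommRing S] [IsDomain S] [AddCommGroup M]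
    [Module S M] : Cardinal :=
  Module.rank (FractionRing S) (FractionRing S ⊗[S] M)

/-- The inclusion `Quot(S) → Quot(B)` induced by an inclusion `S ⊆ B` of a subalgebra of a
domain. -/
noncomputable def fractionInclusion {k B : Type*} [Field k] [CommRing B] [IsDomain B] [Algebra k B]
    (S : Subalgebra k B) : FractionRing S →+* FractionRing B :=
  IsFractionRing.map (A := S) (B := B) (j := algebraMap S B) Subtype.val_injective

/-- A morphism of schemes is birational if it restricts to an isomorphism from a dense open
subscheme of the source onto a dense open subscheme of the target. -/
def IsBirational {X Y : Scheme.{u}} (f : X ⟶ Y) : Prop :=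
  ∃ e : X.PartialIso Y, e.iso.hom ≫ e.target.ι = e.source.ι ≫ f

section ProjMap

variable {A B σ τ : Type u} [CommRing A] [SetLike σ A] [AddSubgroupClass σ A]
  [CommRing B] [SetLike τ B] [AddSubgroupClass τ B]
  {𝒜 : ℕ → σ} {ℬ : ℕ → τ} [GradedRing 𝒜] [GradedRing ℬ]

/-- A family of homogeneous elements of positive degree such that every relevant homogeneous prime
misses one of them gives a cover of `Proj ℬ` by the affine opens `D₊(f i) = Spec ℬ_(f i)`. -/
noncomputable def projCover (ℬ : ℕ → τ) [GradedRing ℬ] {ι : Type u} (f : ι → B) {m : ι → ℕ}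
    (f_deg : ∀ i, f i ∈ ℬ (m i)) (hm : ∀ i, 0 < m i)
    (hf : ∀ p : Proj ℬ, ∃ i, p ∈ Proj.basicOpen ℬ (f i)) : (Proj ℬ).AffineOpenCover where
  I₀ := ι
  X i := .of (Away ℬ (f i))
  f i := Proj.awayι ℬ (f i) (f_deg i) (hm i)
  idx x := (hf x).choose
  covers x := by
    change x ∈ (Proj.awayι ℬ _ _ _).opensRange
    rw [Proj.opensRange_awayι]
    exact (hf x).choose_spec

/-- The contraction along `φ` of every relevant homogeneous prime is relevant. -/
def PullsBackRelevant (φ : 𝒜 →+*ᵍ ℬ) : Prop :=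
  ∀ p : Proj ℬ, ∃ s : (Σ i : PNat, 𝒜 i), p ∈ Proj.basicOpen ℬ (φ (s.2 : A))

theorem awayι_compat (φ : 𝒜 →+*ᵍ ℬ) {m n : ℕ} (hm : 0 < m) (hn : 0 < n) {s t : A} (hs : s ∈ 𝒜 m)
    (ht : t ∈ 𝒜 n) :
    Limits.pullback.fst (Proj.awayι ℬ (φ s) (φ.2 hs) hm) (Proj.awayι ℬ (φ t) (φ.2 ht) hn) ≫
        Spec.map (CommRingCat.ofHom (Away.map φ s)) ≫ Proj.awayι 𝒜 s hs hm =
      Limits.pullback.snd (Proj.awayι ℬ (φ s) (φ.2 hs) hm) (Proj.awayι ℬ (φ t) (φ.2 ht) hn) ≫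
        Spec.map (CommRingCat.ofHom (Away.map φ t)) ≫ Proj.awayι 𝒜 t ht hn := by
  have hs' : φ s ∈ ℬ m := φ.2 hs
  have ht' : φ t ∈ ℬ n := φ.2 ht
  have h1 : (awayMap ℬ ht' (map_mul φ s t)).comp (Away.map φ s) =
      (Away.map φ (s * t)).comp (awayMap 𝒜 ht rfl) := by
    ext x
    obtain ⟨i, a, ha, rfl⟩ := Away.mk_surjective 𝒜 hs x
    simp [awayMap_mk, Away.map_mk, Away.val_mk]
  have h2 : (awayMap ℬ hs' ((map_mul φ s t).trans (mul_comm _ _))).comp (Away.map φ t) =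
      (Away.map φ (s * t)).comp (awayMap 𝒜 hs (mul_comm s t)) := by
    ext x
    obtain ⟨i, a, ha, rfl⟩ := Away.mk_surjective 𝒜 ht x
    simp [awayMap_mk, Away.map_mk, Away.val_mk]
  have e1 := Proj.pullbackAwayιIso_inv_fst ℬ hs' hm ht' hn (map_mul φ s t)
  have e2 := Proj.pullbackAwayιIso_inv_snd ℬ hs' hm ht' hn (map_mul φ s t)
  rw [← cancel_epi (Proj.pullbackAwayιIso ℬ hs' hm ht' hn (map_mul φ s t)).inv,
    ← Category.assoc (Iso.inv _) (Limits.pullback.fst _ _), e1,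
    ← Category.assoc (Iso.inv _) (Limits.pullback.snd _ _), e2]
  rw [← Spec.map_comp_assoc, ← Spec.map_comp_assoc, ← CommRingCat.ofHom_comp,
    ← CommRingCat.ofHom_comp, h1, h2, CommRingCat.ofHom_comp, CommRingCat.ofHom_comp,
    Spec.map_comp_assoc, Spec.map_comp_assoc, Proj.SpecMap_awayMap_awayι,
    Proj.SpecMap_awayMap_awayι]
  rfl

/-- The morphism `Proj ℬ ⟶ Proj 𝒜` induced by `φ : 𝒜 → ℬ`, glued from the morphisms
`Spec ℬ_(φ s) ⟶ Spec 𝒜_(s)` with `s` homogeneous of positive degree. -/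
noncomputable def projMap (φ : 𝒜 →+*ᵍ ℬ) (hφ : PullsBackRelevant φ) : Proj ℬ ⟶ Proj 𝒜 :=
  (projCover ℬ (fun s : (Σ i : PNat, 𝒜 i) => φ (s.2 : A)) (fun s => φ.2 s.2.2)
    (fun s => s.1.2) hφ).openCover.glueMorphisms
    (fun s => Spec.map (CommRingCat.ofHom (Away.map φ (s.2 : A))) ≫
      Proj.awayι 𝒜 (s.2 : A) s.2.2 s.1.2)
    (fun s t => awayι_compat φ s.1.2 t.1.2 s.2.2 t.2.2)

theorem awayι_projMap (φ : 𝒜 →+*ᵍ ℬ) (hφ : PullsBackRelevant φ) {n : ℕ} (hn : 0 < n) (s : A)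
    (hs : s ∈ 𝒜 n) :
    Proj.awayι ℬ (φ s) (φ.2 hs) hn ≫ projMap φ hφ =
      Spec.map (CommRingCat.ofHom (Away.map φ s)) ≫ Proj.awayι 𝒜 s hs hn :=
  Scheme.Cover.ι_glueMorphisms (projCover ℬ (fun s : (Σ i : PNat, 𝒜 i) => φ (s.2 : A))
    (fun s => φ.2 s.2.2) (fun s => s.1.2) hφ).openCover _ _ (⟨⟨n, hn⟩, ⟨s, hs⟩⟩ : Σ i : PNat, 𝒜 i)

end ProjMap

section Semistandard

variable {k : Type v} {R : Type u} [Field k] [CommRing R] [Algebra k R]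
variable (𝒜 : ℕ → Submodule k R) [GradedAlgebra 𝒜]

theorem IsSemistandard.pullsBackRelevant {𝒜 : ℕ → Submodule k R} [GradedAlgebra 𝒜]
    (h0 : 𝒜 0 = 1) (hs : IsSemistandard 𝒜) : PullsBackRelevant (degOneIncl 𝒜) := by
  intro p
  by_contra! H
  have hs' : Algebra.IsIntegral (degOne 𝒜) R := hs
  have hp : p.asHomogeneousIdeal.toIdeal.IsPrime := p.isPrime
  have hmem : ∀ x : degOne 𝒜, ∀ n : ℕ, 0 < n → (x : R) ∈ 𝒜 n →
      (x : R) ∈ p.asHomogeneousIdeal.toIdeal := by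
    intro x n hn hx
    have := H ⟨⟨n, hn⟩, ⟨x, hx⟩⟩
    rw [Proj.mem_basicOpen, not_not] at this
    exact this
  have hdeg0 : ∀ y ∈ 𝒜 0, ∃ c : k, algebraMap k R c = y := by
    intro y hy
    rw [h0] at hy
    simpa using hy
  have hdec : ∀ x : degOne 𝒜, ∃ c : k,
      (x : R) - algebraMap k R c ∈ p.asHomogeneousIdeal.toIdeal := by
    intro x
    classical
    obtain ⟨c, hc⟩ := hdeg0 _ (DirectSum.decompose 𝒜 (x : R) 0).2
    refine ⟨c, ?_⟩
    rw [hc]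
    nth_rewrite 1 [← DirectSum.sum_support_decompose 𝒜 (x : R)]
    by_cases h : 0 ∈ (DirectSum.decompose 𝒜 (x : R)).support
    · rw [← Finset.add_sum_erase _ _ h, add_sub_cancel_left]
      refine Ideal.sum_mem _ fun i hi => ?_
      exact hmem ⟨_, decompose_mem_degOne 𝒜 i x.2⟩ i
        (Nat.pos_of_ne_zero (Finset.ne_of_mem_erase hi)) (DirectSum.decompose 𝒜 (x : R) i).2
    · have h00 : (DirectSum.decompose 𝒜 (x : R) 0 : R) = 0 := by
        simpa using h
      rw [h00, sub_zero]
      refine Ideal.sum_mem _ fun i hi => ?_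
      exact hmem ⟨_, decompose_mem_degOne 𝒜 i x.2⟩ i
        (Nat.pos_of_ne_zero (fun hi0 => h (hi0 ▸ hi))) (DirectSum.decompose 𝒜 (x : R) i).2
  have hmax : (p.asHomogeneousIdeal.toIdeal.comap (algebraMap (degOne 𝒜) R)).IsMaximal := by
    rw [Ideal.isMaximal_iff]
    refine ⟨fun h => hp.ne_top ((Ideal.eq_top_iff_one _).2 (by simpa using h)),
      fun J x hJ hx hxJ => ?_⟩
    obtain ⟨c, hc⟩ := hdec x
    have hc0 : c ≠ 0 := by
      rintro rfl
      rw [map_zero, sub_zero] at hc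
      exact hx hc
    have hcJ : algebraMap k (degOne 𝒜) c ∈ J := by
      have h1 : x - algebraMap k (degOne 𝒜) c ∈ J := hJ hc
      simpa using J.sub_mem hxJ h1
    have h2 := J.mul_mem_left (algebraMap k (degOne 𝒜) c⁻¹) hcJ
    rwa [← map_mul, inv_mul_cancel₀ hc0, map_one] at h2
  have hpmax : p.asHomogeneousIdeal.toIdeal.IsMaximal :=
    Ideal.isMaximal_of_isIntegral_of_isMaximal_comap _ hmax
  refine p.not_irrelevant_le fun x hx => ?_
  by_contra hxp
  obtain ⟨y, z, hz, hyz⟩ := hpmax.exists_inv hxp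
  have hx0 : GradedRing.projZeroRingHom 𝒜 x = 0 := hx
  have h1 := congrArg (GradedRing.projZeroRingHom 𝒜) hyz
  rw [map_add, map_mul, hx0, mul_zero, zero_add, map_one] at h1
  have h2 : (DirectSum.decompose 𝒜 z 0 : R) ∈ p.asHomogeneousIdeal.toIdeal :=
    p.asHomogeneousIdeal.isHomogeneous 0 hz
  rw [GradedRing.projZeroRingHom_apply] at h1
  rw [h1] at h2
  exact hp.ne_top ((Ideal.eq_top_iff_one _).2 h2)

/-- The natural projection `Proj R ⟶ Proj R⁽¹⁾` of a semistandard ring with `R₀ = k`. -/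
noncomputable def projDegOne {𝒜 : ℕ → Submodule k R} [GradedAlgebra 𝒜] (h0 : 𝒜 0 = 1)
    (hs : IsSemistandard 𝒜) : Proj 𝒜 ⟶ Proj (degOneGrading 𝒜) :=
  projMap (degOneIncl 𝒜) (hs.pullsBackRelevant h0)

/-- The natural projection `Spec R ⟶ Spec R⁽¹⁾`. -/
noncomputable def specDegOne (𝒜 : ℕ → Submodule k R) :
    Spec (CommRingCat.of R) ⟶ Spec (CommRingCat.of (degOne 𝒜)) :=
  Spec.map (CommRingCat.ofHom (algebraMap (degOne 𝒜) R))

end Semistandard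

end VirtStd

open VirtStd

/-!
All five conditions are shown equivalent to one elementary statement about the inclusion of
`S = k[R₁]` in `R`, called `GenericallySurjective`: every `r ∈ R` has a nonzero `s ∈ S` with
`s r ∈ S`. Since `R` is a finite `S`-module, a single `s` then works for all of `R`.

For the rank and for the fraction fields this is linear algebra over a domain
(`rankOverDomain_eq_one_iff`, `fractionInclusion_bijective_iff`).

For the multiplicities, integrality gives `dim R = dim S = d`, and a Hilbert–Serre argument
(`quotientHilbertSeries_mul_mem`) shows that both multiplicities exist. It applies to `R` directly,
without graded modules over `S`, because a homogeneous prime of `R` containing `R₁` contains every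
element of positive degree (`IsSemistandard.mem_of_isPrime`). A multiplicity `e` is read off from
`∑_{i ≤ N} dim Aᵢ ∼ e N ^ d / d!` (`HasMultiplicity.tendsto`). If `s R ⊆ S`, then
multiplication by `s` embeds `R` into `S` with bounded shift of degrees, so `e(R) = e(S)`. If some
`r` has no denominator in `S`, then `S ⊕ S r ⊆ R`, so `e(R) ≥ 2 e(S)`; this is more than `e(S)`
because `e(S) > 0`, which follows from Noether normalization
(`exists_pow_le_cumulativeHilbert`).

For the two morphisms of schemes, consider a chart on which the morphism is `Spec φ` for an
injective homomorphism `φ` of domains. A birational morphism is an isomorphism on the stalk at the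
generic point, which makes `φ` generically surjective (`IsBirational.genericallySurjective`);
conversely `φ` becomes an isomorphism after inverting a common denominator
(`isBirational_of_common_denominator`). On spectra the chart is everything. On `Proj` the chart is
`D₊(t)` for a nonzero `t ∈ R₁`, and homogeneous denominators translate between `S → R` and
`S_(t) → R_(t)`. When `R₁ = 0`, both `Proj`s are empty and `S = R`.
-/

namespace VirtStd

/-! ### Krull dimension and integral extensions -/

theorem ringKrullDim_le_of_isIntegral (S B : Type*) [CommRing S] [CommRing B] [Algebra S B]
    [Algebra.IsIntegral S B] : ringKrullDim B ≤ ringKrullDim S :=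
  Order.krullDim_le_of_strictMono (PrimeSpectrum.comap (algebraMap S B)) fun _ _ h =>
    Ideal.IsIntegral.comap_lt_comap h

theorem ringKrullDim_eq_of_isIntegral (S B : Type*) [CommRing S] [CommRing B] [Algebra S B]
    [Algebra.IsIntegral S B] (hinj : Function.Injective (algebraMap S B)) :
    ringKrullDim B = ringKrullDim S := by
  refine le_antisymm (ringKrullDim_le_of_isIntegral S B) (iSup_le fun l => ?_)
  have hker : RingHom.ker (algebraMap S B) ≤ l.head.asIdeal := by
    rw [(RingHom.injective_iff_ker_eq_bot _).1 hinj]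
    exact bot_le
  obtain ⟨P, -, hP, hPl⟩ :=
    Ideal.exists_ideal_over_prime_of_isIntegral (S := B) l.head.asIdeal ⊥ hker
  have : P.LiesOver l.head.asIdeal := ⟨hPl.symm⟩
  obtain ⟨L, hL, -⟩ := Ideal.exists_ltSeries_of_hasGoingUp (S := B) l P
  rw [← hL]
  exact le_iSup (fun p : LTSeries (PrimeSpectrum B) => (p.length : WithBot ℕ∞)) L

theorem exists_natCast_eq_ringKrullDim (k : Type v) (A : Type u) [Field k] [CommRing A]
    [Nontrivial A] [Algebra k A] [Algebra.FiniteType k A] : ∃ d : ℕ, ringKrullDim A = d := by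
  obtain ⟨s, g, -, hint⟩ := exists_integral_inj_algHom_of_fg k A
  algebraize [g.toRingHom]
  have : Algebra.IsIntegral (MvPolynomial (Fin s) k) A := ⟨hint⟩
  have h := ringKrullDim_le_of_isIntegral (MvPolynomial (Fin s) k) A
  rw [MvPolynomial.ringKrullDim_of_isNoetherianRing, ringKrullDim_eq_zero_of_field,
    zero_add, Nat.card_fin] at h
  have h' := ringKrullDim_nonneg_of_nontrivial (R := A)
  cases hd : ringKrullDim A with
  | bot => simp [hd] at h'
  | coe d =>
    rw [hd] at h
    have h2 : d ≤ (s : ℕ∞) := by exact_mod_cast h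
    lift d to ℕ using ne_top_of_le_ne_top (ENat.natCast_ne_top s) h2
    exact ⟨d, rfl⟩

/-! ### Rationality of Hilbert series -/

section HilbertSerre

variable {k : Type v} {A : Type u} [Field k] [CommRing A] [Algebra k A]

/-- `dim f(M) - dim f(N) = dim M - dim N` when `N ⊆ M` contains the kernel of `f` on `M`. -/
theorem finrank_map_add_finrank_of_ker_inf_le {V W : Type*} [AddCommGroup V] [Module k V]
    [AddCommGroup W] [Module k W] (f : V →ₗ[k] W) {M N : Submodule k V} [FiniteDimensional k M]
    (hNM : N ≤ M) (hN : LinearMap.ker f ⊓ M ≤ N) :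
    Module.finrank k (M.map f) + Module.finrank k N =
      Module.finrank k (N.map f) + Module.finrank k M := by
  have key : ∀ P : Submodule k V, FiniteDimensional k P →
      Module.finrank k (P.map f) + Module.finrank k (P ⊓ LinearMap.ker f : Submodule k V) =
        Module.finrank k P := by
    intro P _
    have h := LinearMap.finrank_range_add_finrank_ker (f.domRestrict P)
    rwa [LinearMap.range_domRestrict, LinearMap.ker_domRestrict,
      ← Submodule.finrank_map_subtype_eq, Submodule.map_comap_subtype] at h
  have : FiniteDimensional k N := Submodule.finiteDimensional_of_le hNM
  have h1 := key M inferInstance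
  have h2 := key N inferInstance
  have h3 : N ⊓ LinearMap.ker f = M ⊓ LinearMap.ker f :=
    le_antisymm (inf_le_inf_right _ hNM) (le_inf ((inf_comm _ _).trans_le hN) inf_le_right)
  rw [h3] at h2
  omega

variable (𝒜 : ℕ → Submodule k A)

/-- The degree `n` part of an ideal, as a `k`-subspace of `A`. -/
def idealPart (I : Ideal A) (n : ℕ) : Submodule k A := I.restrictScalars k ⊓ 𝒜 n

/-- The Hilbert series of `A ⧸ I` for a homogeneous ideal `I`, with coefficients written as
`dim Aₙ - dim (I ∩ Aₙ)` to avoid grading the quotient. -/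
noncomputable def quotientHilbertSeries (I : Ideal A) : PowerSeries ℤ :=
  PowerSeries.mk fun n =>
    (Module.finrank k (𝒜 n) : ℤ) - Module.finrank k (idealPart 𝒜 I n)

theorem quotientHilbertSeries_bot : quotientHilbertSeries 𝒜 ⊥ = hilbertSeries 𝒜 := by
  ext n
  have : idealPart 𝒜 ⊥ n = ⊥ := by simp [idealPart]
  simp only [quotientHilbertSeries, hilbertSeries, PowerSeries.coeff_mk]
  rw [this, finrank_bot, Nat.cast_zero, sub_zero]

theorem quotientHilbertSeries_top : quotientHilbertSeries 𝒜 ⊤ = 0 := by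
  ext n
  have : idealPart 𝒜 ⊤ n = 𝒜 n := by simp [idealPart]
  simp only [quotientHilbertSeries, PowerSeries.coeff_mk, map_zero]
  rw [this, sub_self]

/-- The ideal quotient `I : a`. -/
def colonElement (I : Ideal A) (a : A) : Ideal A := Submodule.comap (LinearMap.mulLeft A a) I

theorem mem_colonElement {I : Ideal A} {a x : A} : x ∈ colonElement I a ↔ a * x ∈ I := Iff.rfl

/-- The power series over `ℤ` that are polynomials. -/
noncomputable abbrev polynomialSeries : Subring (PowerSeries ℤ) :=
  (Polynomial.coeToPowerSeries.ringHom (R := ℤ)).range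

theorem quotientHilbertSeries_mem_of_irrelevant_le {I : Ideal A}
    (hI : ∀ n, 0 < n → ∀ x ∈ 𝒜 n, x ∈ I) :
    quotientHilbertSeries 𝒜 I ∈ polynomialSeries := by
  refine ⟨Polynomial.C (PowerSeries.coeff 0 (quotientHilbertSeries 𝒜 I)), ?_⟩
  ext n
  rcases Nat.eq_zero_or_pos n with rfl | hn
  · simp
  · have : idealPart 𝒜 I n = 𝒜 n := inf_eq_right.2 fun x hx => hI n hn x hx
    simp only [quotientHilbertSeries, PowerSeries.coeff_mk]
    rw [this, sub_self]
    simp [hn.ne']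

variable [GradedAlgebra 𝒜]

theorem isHomogeneous_colonElement {I : Ideal A} (hI : I.IsHomogeneous 𝒜) {a : A} {e : ℕ}
    (ha : a ∈ 𝒜 e) : (colonElement I a).IsHomogeneous 𝒜 := by
  intro n x hx
  rw [mem_colonElement] at hx ⊢
  have h := hI (e + n) hx
  rwa [DirectSum.coe_decompose_mul_add_of_left_mem 𝒜 ha] at h

/-- The Hilbert series form of the exact sequence
`0 → (A ⧸ (I : a))(-e) → A ⧸ I → A ⧸ (I + (a)) → 0`. -/
theorem quotientHilbertSeries_eq_add [∀ n, FiniteDimensional k (𝒜 n)] {I : Ideal A}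
    (hI : I.IsHomogeneous 𝒜) {a : A} {e : ℕ} (ha : a ∈ 𝒜 e) :
    quotientHilbertSeries 𝒜 I =
      PowerSeries.X ^ e * quotientHilbertSeries 𝒜 (colonElement I a) +
        quotientHilbertSeries 𝒜 (I ⊔ Ideal.span {a}) := by
  ext m
  rw [map_add, PowerSeries.coeff_X_pow_mul']
  simp only [quotientHilbertSeries, PowerSeries.coeff_mk]
  split_ifs with hm
  · obtain ⟨n, rfl⟩ := Nat.exists_eq_add_of_le hm
    rw [Nat.add_sub_cancel_left]
    have hsup : idealPart 𝒜 (I ⊔ Ideal.span {a}) (e + n) =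
        idealPart 𝒜 I (e + n) ⊔ (𝒜 n).map (LinearMap.mulLeft k a) := by
      apply le_antisymm
      · rintro y ⟨hy, hyd⟩
        obtain ⟨i, hi, z, hz, rfl⟩ := Submodule.mem_sup.1 hy
        obtain ⟨c, rfl⟩ := Ideal.mem_span_singleton'.1 hz
        rw [← DirectSum.decompose_of_mem_same 𝒜 hyd, DirectSum.decompose_add,
          DirectSum.add_apply, Submodule.coe_add, mul_comm c a,
          DirectSum.coe_decompose_mul_add_of_left_mem 𝒜 ha]
        exact Submodule.add_mem_sup ⟨hI _ hi, (DirectSum.decompose 𝒜 i (e + n)).2⟩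
          ⟨_, (DirectSum.decompose 𝒜 c n).2, rfl⟩
      · refine sup_le (fun y hy => ⟨Ideal.mem_sup_left hy.1, hy.2⟩) ?_
        rintro _ ⟨c, hc, rfl⟩
        exact ⟨Ideal.mem_sup_right (Ideal.mul_mem_right _ _ (Ideal.mem_span_singleton_self a)),
          SetLike.mul_mem_graded ha hc⟩
    have hinf : idealPart 𝒜 I (e + n) ⊓ (𝒜 n).map (LinearMap.mulLeft k a) =
        (idealPart 𝒜 (colonElement I a) n).map (LinearMap.mulLeft k a) := by
      apply le_antisymm
      · rintro _ ⟨⟨hy, -⟩, c, hc, rfl⟩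
        exact ⟨c, ⟨hy, hc⟩, rfl⟩
      · rintro _ ⟨c, ⟨hc, hcd⟩, rfl⟩
        exact ⟨⟨hc, SetLike.mul_mem_graded ha hcd⟩, c, hcd, rfl⟩
    have hfd : FiniteDimensional k (idealPart 𝒜 I (e + n)) :=
      Submodule.finiteDimensional_of_le (inf_le_right : _ ≤ 𝒜 (e + n))
    have h1 := Submodule.finrank_sup_add_finrank_inf_eq (idealPart 𝒜 I (e + n))
      ((𝒜 n).map (LinearMap.mulLeft k a))
    rw [← hsup, hinf] at h1
    have h2 := finrank_map_add_finrank_of_ker_inf_le (LinearMap.mulLeft k a)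
      (M := 𝒜 n) (N := idealPart 𝒜 (colonElement I a) n) inf_le_right (by
        rintro x ⟨hx, hxd⟩
        refine ⟨?_, hxd⟩
        change a * x ∈ I
        rw [show a * x = 0 from hx]
        exact I.zero_mem)
    omega
  · have : idealPart 𝒜 (I ⊔ Ideal.span {a}) m = idealPart 𝒜 I m := by
      apply le_antisymm
      · rintro y ⟨hy, hyd⟩
        refine ⟨?_, hyd⟩
        obtain ⟨i, hi, z, hz, rfl⟩ := Submodule.mem_sup.1 hy
        obtain ⟨c, rfl⟩ := Ideal.mem_span_singleton'.1 hz
        rw [← DirectSum.decompose_of_mem_same 𝒜 hyd, DirectSum.decompose_add,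
          DirectSum.add_apply, Submodule.coe_add, mul_comm c a,
          DirectSum.coe_decompose_mul_of_left_mem_of_not_le 𝒜 ha hm, add_zero]
        exact hI _ hi
      · exact fun y hy => ⟨Ideal.mem_sup_left hy.1, hy.2⟩
    rw [this, zero_add]

theorem one_sub_X_mem_polynomialSeries : (1 - PowerSeries.X : PowerSeries ℤ) ∈ polynomialSeries :=
  ⟨1 - Polynomial.X, by simp⟩

theorem X_mem_polynomialSeries : (PowerSeries.X : PowerSeries ℤ) ∈ polynomialSeries :=
  ⟨Polynomial.X, by simp⟩

/-- **Hilbert–Serre**: the Hilbert series of `A ⧸ I` has a pole at `1` of order at most the Krull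
dimension. This is proved by Noetherian induction on `I`, cutting by an element of degree one when
`I` is prime and splitting `A ⧸ I` by a zero divisor otherwise. -/
theorem quotientHilbertSeries_mul_mem [∀ n, FiniteDimensional k (𝒜 n)] [IsNoetherianRing A]
    (hrel : ∀ P : Ideal A, P.IsPrime → P.IsHomogeneous 𝒜 → (∀ x ∈ 𝒜 1, x ∈ P) →
      ∀ n, 0 < n → ∀ x ∈ 𝒜 n, x ∈ P) (I : Ideal A) :
    I.IsHomogeneous 𝒜 → ∀ d : ℕ, ringKrullDim (A ⧸ I) ≤ d →
      quotientHilbertSeries 𝒜 I * (1 - PowerSeries.X) ^ d ∈ polynomialSeries := by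
  induction I using WellFoundedGT.induction with
  | ind I ih =>
  intro hI d hd
  have hspan : ∀ {x : A} {e : ℕ}, x ∈ 𝒜 e → (I ⊔ Ideal.span {x}).IsHomogeneous 𝒜 := by
    intro x e hx
    exact hI.sup (Ideal.homogeneous_span _ _ (by rintro y rfl; exact ⟨e, hx⟩))
  have hlt : ∀ {x : A}, x ∉ I → I < I ⊔ Ideal.span {x} := fun {x} hx =>
    lt_of_le_of_ne le_sup_left fun h => hx
      (h ▸ Ideal.mem_sup_right (Ideal.mem_span_singleton_self x))
  by_cases hprime : I.IsPrime
  · by_cases h1 : ∀ x ∈ 𝒜 1, x ∈ I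
    · exact mul_mem (quotientHilbertSeries_mem_of_irrelevant_le 𝒜 (hrel I hprime hI h1))
        (pow_mem one_sub_X_mem_polynomialSeries d)
    · push Not at h1
      obtain ⟨x, hx, hxI⟩ := h1
      have hcolon : colonElement I x = I := by
        ext y
        rw [mem_colonElement]
        exact ⟨fun h => (hprime.mem_or_mem h).resolve_left hxI, fun h => I.mul_mem_left _ h⟩
      -- As `I : x = I`, multiplying by `1 - X` turns the series of `I` into that of `I + (x)`,
      -- whose quotient has smaller dimension.
      have hH := quotientHilbertSeries_eq_add 𝒜 hI hx
      rw [hcolon, pow_one] at hH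
      have hH' : quotientHilbertSeries 𝒜 I * (1 - PowerSeries.X) =
          quotientHilbertSeries 𝒜 (I ⊔ Ideal.span {x}) := by
        linear_combination hH
      have hdim : ringKrullDim (A ⧸ I ⊔ Ideal.span {x}) + 1 ≤ ringKrullDim (A ⧸ I) := by
        refine ringKrullDim_succ_le_of_surjective
          (Ideal.Quotient.factor (le_sup_left : I ≤ I ⊔ Ideal.span {x}))
          (Ideal.Quotient.factor_surjective le_sup_left) (r := Ideal.Quotient.mk I x) ?_ ?_
        · rw [mem_nonZeroDivisors_iff_ne_zero, Ne, Ideal.Quotient.eq_zero_iff_mem]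
          exact hxI
        · rw [Ideal.Quotient.factor_mk, Ideal.Quotient.eq_zero_iff_mem]
          exact Ideal.mem_sup_right (Ideal.mem_span_singleton_self x)
      cases d with
      | zero =>
        -- The dimension cannot drop below zero, so the quotient by `I + (x)` is trivial.
        have htop : I ⊔ Ideal.span {x} = ⊤ := by
          by_contra hne
          have := Ideal.Quotient.nontrivial_iff.mpr hne
          have h2 := (add_le_add_left
            (ringKrullDim_nonneg_of_nontrivial (R := A ⧸ I ⊔ Ideal.span {x})) 1).trans
            (hdim.trans hd)
          norm_num at h2
        rw [htop, quotientHilbertSeries_top] at hH'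
        have h3 : (1 - PowerSeries.X : PowerSeries ℤ) ≠ 0 := fun h => by
          simpa using congrArg (PowerSeries.coeff 0) h
        rw [(mul_eq_zero.1 hH').resolve_right h3, zero_mul]
        exact zero_mem _
      | succ d =>
        have h4 : ringKrullDim (A ⧸ I ⊔ Ideal.span {x}) ≤ d := by
          have h5 := hdim.trans hd
          push_cast at h5
          exact ENat.WithBot.add_le_add_one_right_iff.1 h5
        rw [pow_succ', ← mul_assoc, hH']
        exact ih _ (hlt hxI) (hspan hx) d h4
  · by_cases htop : I = ⊤
    · rw [htop, quotientHilbertSeries_top, zero_mul]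
      exact zero_mem _
    · rw [hI.isPrime_iff] at hprime
      push Not at hprime
      -- Both `I : a`, which contains `b`, and `I + (a)` are strictly larger than `I`.
      obtain ⟨a, b, ⟨e, ha⟩, -, hab, haI, hbI⟩ := hprime htop
      rw [quotientHilbertSeries_eq_add 𝒜 hI ha, add_mul, mul_assoc]
      have hle : I ≤ colonElement I a := fun y hy => I.mul_mem_left _ hy
      have hdim : ∀ {J : Ideal A}, I ≤ J → ringKrullDim (A ⧸ J) ≤ d := fun h =>
        (ringKrullDim_le_of_surjective (Ideal.Quotient.factor h)
          (Ideal.Quotient.factor_surjective h)).trans hd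
      refine add_mem (mul_mem (pow_mem X_mem_polynomialSeries e)
        (ih _ ?_ (isHomogeneous_colonElement 𝒜 hI ha) d (hdim hle)))
        (ih _ (hlt haI) (hspan ha) d (hdim le_sup_left))
      exact lt_of_le_of_ne hle fun h => hbI (by rw [h]; exact hab)

end HilbertSerre

/-! ### Growth of Hilbert functions and multiplicity -/

section Growth

open Filter Topology

theorem tendsto_choose_sub_div_pow (d j : ℕ) :
    Tendsto (fun N : ℕ => ((d + (N - j)).choose d : ℝ) / (N : ℝ) ^ d) atTop
      (𝓝 (1 / (d.factorial : ℝ))) := by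
  have hshift : Tendsto (fun N : ℕ => d + (N - j)) atTop atTop :=
    tendsto_atTop_mono (fun N => (by omega : N - j ≤ d + (N - j))) (tendsto_sub_atTop_nat j)
  have h1 : Tendsto (fun N : ℕ => (N.choose d : ℝ) / (N : ℝ) ^ d) atTop
      (𝓝 (1 / (d.factorial : ℝ))) := by
    have h := (Asymptotics.isEquivalent_iff_tendsto_one (by
      filter_upwards [eventually_gt_atTop 0] with N hN
      have : (N : ℝ) ≠ 0 := by positivity
      positivity)).1 (isEquivalent_choose d)
    have h' := h.div_const (d.factorial : ℝ)
    refine h'.congr fun N => ?_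
    simp only [Pi.div_apply]
    have : (d.factorial : ℝ) ≠ 0 := by positivity
    field_simp
  have h2 : Tendsto (fun N : ℕ => ((d + (N - j) : ℕ) : ℝ) / (N : ℝ)) atTop (𝓝 1) := by
    have h3 : Tendsto (fun N : ℕ => 1 + ((d : ℝ) - j) / (N : ℝ)) atTop (𝓝 (1 + 0)) :=
      tendsto_const_nhds.add (tendsto_const_div_atTop_nhds_zero_nat _)
    rw [add_zero] at h3
    refine h3.congr' ?_
    filter_upwards [eventually_ge_atTop j, eventually_gt_atTop 0] with N hN hN0
    have : (N : ℝ) ≠ 0 := by positivity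
    push_cast [Nat.cast_sub hN]
    field_simp
    ring
  have h4 := (h1.comp hshift).mul (h2.pow d)
  rw [one_pow, mul_one] at h4
  refine h4.congr' ?_
  filter_upwards [eventually_ge_atTop (j + 1)] with N hN
  have h5 : ((d + (N - j) : ℕ) : ℝ) ≠ 0 := by
    have : 0 < d + (N - j) := by omega
    positivity
  simp only [Function.comp_apply]
  rw [div_pow]
  field_simp

variable {k : Type v} {A : Type u} [Field k] [CommRing A] [Algebra k A]

/-- The cumulative Hilbert function `N ↦ ∑_{i ≤ N} dim Aᵢ`. -/
noncomputable def cumulativeHilbert (𝒜 : ℕ → Submodule k A) (N : ℕ) : ℕ :=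
  ∑ i ∈ Finset.range (N + 1), Module.finrank k (𝒜 i)

theorem cumulativeHilbert_eq_coeff (𝒜 : ℕ → Submodule k A) {d : ℕ} {Q : Polynomial ℤ}
    (hQ : hilbertSeries 𝒜 * (1 - PowerSeries.X) ^ d = (Q : PowerSeries ℤ)) (N : ℕ) :
    (cumulativeHilbert 𝒜 N : ℤ) = PowerSeries.coeff N
      ((Q : PowerSeries ℤ) * PowerSeries.mk fun n => ((d + n).choose d : ℤ)) := by
  have h1 : hilbertSeries 𝒜 * PowerSeries.mk 1 =
      (Q : PowerSeries ℤ) * PowerSeries.mk fun n => ((d + n).choose d : ℤ) := by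
    rw [← PowerSeries.mk_one_pow_eq_mk_choose_add, ← hQ, pow_succ, mul_assoc,
      ← mul_assoc ((1 - PowerSeries.X) ^ d), ← mul_pow, mul_comm (1 - PowerSeries.X),
      PowerSeries.mk_one_mul_one_sub_eq_one, one_pow, one_mul]
  rw [← h1, PowerSeries.coeff_mul, Finset.Nat.sum_antidiagonal_eq_sum_range_succ_mk]
  simp [cumulativeHilbert, hilbertSeries]

/-- A graded algebra of dimension `d` and multiplicity `e` satisfies
`∑_{i ≤ N} dim Aᵢ ∼ e N ^ d / d!`. -/
theorem HasMultiplicity.tendsto {𝒜 : ℕ → Submodule k A} {e : ℤ} (h : HasMultiplicity 𝒜 e) {d : ℕ}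
    (hd : ringKrullDim A = d) :
    Tendsto (fun N : ℕ => (cumulativeHilbert 𝒜 N : ℝ) / (N : ℝ) ^ d) atTop
      (𝓝 ((e : ℝ) / (d.factorial : ℝ))) := by
  obtain ⟨d', Q, hd', hQ, rfl⟩ := h
  obtain rfl : d' = d := by
    have := hd'.symm.trans hd
    exact_mod_cast this
  have hlim : Tendsto (fun N : ℕ => ∑ j ∈ Finset.range (Q.natDegree + 1),
      (Q.coeff j : ℝ) * (((d' + (N - j)).choose d' : ℝ) / (N : ℝ) ^ d')) atTop
      (𝓝 (∑ j ∈ Finset.range (Q.natDegree + 1), (Q.coeff j : ℝ) * (1 / (d'.factorial : ℝ)))) :=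
    tendsto_finsetSum _ fun j _ => (tendsto_choose_sub_div_pow d' j).const_mul _
  rw [Polynomial.eval_eq_sum_range]
  have hval : ∑ j ∈ Finset.range (Q.natDegree + 1), (Q.coeff j : ℝ) * (1 / (d'.factorial : ℝ)) =
      ((∑ j ∈ Finset.range (Q.natDegree + 1), Q.coeff j * 1 ^ j : ℤ) : ℝ) / d'.factorial := by
    push_cast
    simp [← Finset.sum_mul, div_eq_mul_inv]
  rw [hval] at hlim
  refine hlim.congr' ?_
  filter_upwards [eventually_ge_atTop Q.natDegree] with N hN
  have h1 := cumulativeHilbert_eq_coeff 𝒜 hQ N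
  rw [PowerSeries.coeff_mul, Finset.Nat.sum_antidiagonal_eq_sum_range_succ_mk] at h1
  simp only [Polynomial.coeff_coe, PowerSeries.coeff_mk] at h1
  rw [← Finset.sum_subset (Finset.range_mono (by omega : Q.natDegree + 1 ≤ N + 1))] at h1
  · rw [show (cumulativeHilbert 𝒜 N : ℝ) = ((cumulativeHilbert 𝒜 N : ℤ) : ℝ) by simp, h1]
    push_cast
    rw [Finset.sum_div]
    exact Finset.sum_congr rfl fun j _ => by rw [mul_div_assoc]
  · intro j _ hj
    rw [Finset.mem_range, not_lt] at hj
    rw [Polynomial.coeff_eq_zero_of_natDegree_lt (by omega), zero_mul]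

/-- Passing to a shift does not change the leading term of the cumulative Hilbert function. -/
theorem HasMultiplicity.tendsto_shift {𝒜 : ℕ → Submodule k A} {e : ℤ}
    (h : HasMultiplicity 𝒜 e) {d : ℕ} (hd : ringKrullDim A = d) (a : ℕ) :
    Tendsto (fun N : ℕ => (cumulativeHilbert 𝒜 (N + a) : ℝ) / (N : ℝ) ^ d) atTop
      (𝓝 ((e : ℝ) / (d.factorial : ℝ))) := by
  have h1 := (h.tendsto hd).comp (tendsto_add_atTop_nat a)
  have h2 : Tendsto (fun N : ℕ => ((N + a : ℕ) : ℝ) / (N : ℝ)) atTop (𝓝 1) := by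
    have h3 : Tendsto (fun N : ℕ => 1 + (a : ℝ) / (N : ℝ)) atTop (𝓝 (1 + 0)) :=
      tendsto_const_nhds.add (tendsto_const_div_atTop_nhds_zero_nat _)
    rw [add_zero] at h3
    refine h3.congr' ?_
    filter_upwards [eventually_gt_atTop 0] with N hN
    have : (N : ℝ) ≠ 0 := by positivity
    push_cast
    field_simp
  have h4 := h1.mul (h2.pow d)
  rw [one_pow, mul_one] at h4
  refine h4.congr' ?_
  filter_upwards [eventually_gt_atTop 0] with N hN
  have : ((N + a : ℕ) : ℝ) ≠ 0 := by positivity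
  simp only [Function.comp_apply]
  rw [div_pow]
  field_simp

variable (𝒜 : ℕ → Submodule k A) [GradedAlgebra 𝒜]

/-- The subspace of elements all of whose components have degree at most `N`. -/
def degreeLE (N : ℕ) : Submodule k A where
  carrier := {x | ∀ n, N < n → (DirectSum.decompose 𝒜 x n : A) = 0}
  zero_mem' := by simp
  add_mem' := fun {x y} hx hy n hn => by simp [hx n hn, hy n hn]
  smul_mem' := fun c x hx n hn => by
    rw [DirectSum.decompose_smul]
    exact (congrArg (c • ·) (hx n hn)).trans (smul_zero c)

theorem mem_degreeLE {N : ℕ} {x : A} :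
    x ∈ degreeLE 𝒜 N ↔ ∀ n, N < n → (DirectSum.decompose 𝒜 x n : A) = 0 := Iff.rfl

theorem mem_degreeLE_of_mem {n : ℕ} {x : A} (hx : x ∈ 𝒜 n) : x ∈ degreeLE 𝒜 n := fun m hm =>
  DirectSum.decompose_of_mem_ne 𝒜 hx (by omega)

theorem degreeLE_mono {M N : ℕ} (h : M ≤ N) : degreeLE 𝒜 M ≤ degreeLE 𝒜 N :=
  fun _ hx n hn => hx n (by omega)

theorem exists_mem_degreeLE (x : A) : ∃ N, x ∈ degreeLE 𝒜 N := by
  classical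
  refine ⟨(DirectSum.decompose 𝒜 x).support.sup id, fun n hn => ?_⟩
  by_contra hne
  have : n ∈ (DirectSum.decompose 𝒜 x).support := by
    rw [DFinsupp.mem_support_iff]
    exact fun h => hne (by rw [h]; rfl)
  exact absurd (Finset.le_sup (f := id) this) (by simpa using hn)

theorem sum_decompose_of_mem_degreeLE {N : ℕ} {x : A} (hx : x ∈ degreeLE 𝒜 N) :
    ∑ i ∈ Finset.range (N + 1), (DirectSum.decompose 𝒜 x i : A) = x := by
  classical
  conv_rhs => rw [← DirectSum.sum_support_decompose 𝒜 x]
  symm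
  refine Finset.sum_subset (fun i hi => ?_) fun i _ hi => ?_
  · rw [Finset.mem_range]
    by_contra h
    rw [DFinsupp.mem_support_iff] at hi
    exact hi (Subtype.ext (hx i (by omega)))
  · rw [DFinsupp.notMem_support_iff] at hi
    rw [hi]
    rfl

theorem mul_mem_degreeLE {M N : ℕ} {x y : A} (hx : x ∈ degreeLE 𝒜 M) (hy : y ∈ degreeLE 𝒜 N) :
    x * y ∈ degreeLE 𝒜 (M + N) := by
  rw [← sum_decompose_of_mem_degreeLE 𝒜 hx, ← sum_decompose_of_mem_degreeLE 𝒜 hy,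
    Finset.sum_mul_sum]
  refine sum_mem fun i hi => sum_mem fun j hj => ?_
  rw [Finset.mem_range] at hi hj
  exact degreeLE_mono 𝒜 (by omega) (mem_degreeLE_of_mem 𝒜
    (SetLike.mul_mem_graded (DirectSum.decompose 𝒜 x i).2 (DirectSum.decompose 𝒜 y j).2))

theorem one_mem_degreeLE : (1 : A) ∈ degreeLE 𝒜 0 :=
  mem_degreeLE_of_mem 𝒜 SetLike.GradedOne.one_mem

theorem pow_mem_degreeLE {c : ℕ} {x : A} (hx : x ∈ degreeLE 𝒜 c) (n : ℕ) :
    x ^ n ∈ degreeLE 𝒜 (c * n) := by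
  induction n with
  | zero => simpa using one_mem_degreeLE 𝒜
  | succ n ih =>
    rw [pow_succ, mul_add, mul_one]
    exact mul_mem_degreeLE 𝒜 ih hx

theorem prod_mem_degreeLE {ι : Type*} (s : Finset ι) {c : ℕ} {f : ι → A}
    (hf : ∀ i ∈ s, f i ∈ degreeLE 𝒜 c) : ∏ i ∈ s, f i ∈ degreeLE 𝒜 (c * s.card) := by
  classical
  induction s using Finset.induction_on with
  | empty => simpa using one_mem_degreeLE 𝒜
  | insert a s ha ih =>
    rw [Finset.prod_insert ha, Finset.card_insert_of_notMem ha, mul_add, mul_one, add_comm]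
    exact mul_mem_degreeLE 𝒜 (hf a (Finset.mem_insert_self _ _))
      (ih fun i hi => hf i (Finset.mem_insert_of_mem hi))

/-- The graded pieces of degree at most `N`, as a linear equivalence. -/
noncomputable def degreeLEEquiv (N : ℕ) :
    degreeLE 𝒜 N ≃ₗ[k] ((i : Fin (N + 1)) → 𝒜 i) where
  toFun x i := DirectSum.decompose 𝒜 (x : A) i
  map_add' x y := by ext i; simp
  map_smul' c x := by ext i; rw [Submodule.coe_smul, DirectSum.decompose_smul]; rfl
  invFun f := ⟨∑ i, (f i : A), sum_mem fun i _ =>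
    degreeLE_mono 𝒜 (by omega : (i : ℕ) ≤ N) (mem_degreeLE_of_mem 𝒜 (f i).2)⟩
  left_inv x := Subtype.ext (by
    have h := sum_decompose_of_mem_degreeLE 𝒜 x.2
    rwa [Finset.sum_range] at h)
  right_inv f := by
    ext i
    change ((DirectSum.decompose 𝒜 (∑ j, (f j : A)) i : 𝒜 i) : A) = f i
    rw [DirectSum.decompose_sum, DFinsupp.finsetSum_apply, AddSubmonoidClass.coe_finsetSum,
      Finset.sum_eq_single i]
    · rw [DirectSum.decompose_of_mem_same 𝒜 (f i).2]
    · intro j _ hj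
      exact DirectSum.decompose_of_mem_ne 𝒜 (f j).2 fun h => hj (Fin.ext h)
    · simp

theorem finiteDimensional_degreeLE [∀ n, FiniteDimensional k (𝒜 n)] (N : ℕ) :
    FiniteDimensional k (degreeLE 𝒜 N) :=
  LinearEquiv.finiteDimensional (degreeLEEquiv 𝒜 N).symm

theorem finrank_degreeLE [∀ n, FiniteDimensional k (𝒜 n)] (N : ℕ) :
    Module.finrank k (degreeLE 𝒜 N) = cumulativeHilbert 𝒜 N := by
  rw [(degreeLEEquiv 𝒜 N).finrank_eq, Module.finrank_pi_fintype, cumulativeHilbert,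
    Finset.sum_range]

/-- By Noether normalization `A` contains `d` algebraically independent elements, where
`d = dim A`; their monomials make the Hilbert function grow at least like `N ^ d`. -/
theorem exists_pow_le_cumulativeHilbert [∀ n, FiniteDimensional k (𝒜 n)] [Nontrivial A]
    [Algebra.FiniteType k A] {d : ℕ} (hd : ringKrullDim A = d) :
    ∃ c : ℕ, 0 < c ∧ ∀ N : ℕ, N ^ d ≤ cumulativeHilbert 𝒜 (c * N) := by
  obtain ⟨s, g, hg, hint⟩ := exists_integral_inj_algHom_of_fg k A
  have hds : d ≤ s := by
    algebraize [g.toRingHom]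
    have : Algebra.IsIntegral (MvPolynomial (Fin s) k) A := ⟨hint⟩
    have h := ringKrullDim_le_of_isIntegral (MvPolynomial (Fin s) k) A
    rw [hd, MvPolynomial.ringKrullDim_of_isNoetherianRing, ringKrullDim_eq_zero_of_field,
      zero_add, Nat.card_fin] at h
    exact_mod_cast h
  choose c hc using fun i : Fin s => exists_mem_degreeLE 𝒜 (g (MvPolynomial.X i))
  set C := Finset.univ.sup c with hC
  have hc' : ∀ i, g (MvPolynomial.X i) ∈ degreeLE 𝒜 C := fun i =>
    degreeLE_mono 𝒜 (Finset.le_sup (Finset.mem_univ i)) (hc i)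
  -- A monomial in `s` variables with exponents below `N` has image of degree at most `C * s * N`;
  -- the summand `1` only makes the constant positive.
  refine ⟨C * s + 1, by omega, fun N => ?_⟩
  rcases Nat.eq_zero_or_pos N with rfl | hN
  · rcases Nat.eq_zero_or_pos d with rfl | hd0
    · have h1 : (⟨1, one_mem_degreeLE 𝒜⟩ : degreeLE 𝒜 0) ≠ 0 := fun h =>
        one_ne_zero (congrArg Subtype.val h)
      have := finiteDimensional_degreeLE 𝒜 0
      have : Nontrivial (degreeLE 𝒜 0) := ⟨⟨_, _, h1⟩⟩
      rw [mul_zero, ← finrank_degreeLE, pow_zero]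
      exact Module.finrank_pos
    · simp [hd0.ne']
  refine (Nat.pow_le_pow_right hN hds).trans ?_
  have := finiteDimensional_degreeLE 𝒜 ((C * s + 1) * N)
  let m : (Fin s → Fin N) → (Fin s →₀ ℕ) := fun a =>
    Finsupp.equivFunOnFinite.symm fun i => (a i : ℕ)
  have hm : Function.Injective m := fun a b h => by
    funext i
    exact Fin.ext (by simpa [m] using DFunLike.congr_fun h i)
  have hli : LinearIndependent k fun a : Fin s → Fin N => g (MvPolynomial.monomial (m a) 1) := by
    have h1 := ((MvPolynomial.basisMonomials (Fin s) k).linearIndependent.comp m hm).map'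
      g.toLinearMap (LinearMap.ker_eq_bot.2 hg)
    simpa [Function.comp_def] using h1
  have hmem : ∀ a, g (MvPolynomial.monomial (m a) 1) ∈ degreeLE 𝒜 ((C * s + 1) * N) := by
    intro a
    rw [MvPolynomial.monomial_eq, MvPolynomial.C_1, one_mul, Finsupp.prod_fintype _ _ (by simp),
      map_prod]
    have h2 := prod_mem_degreeLE 𝒜 Finset.univ (c := C * N)
      (f := fun i => g (MvPolynomial.X i ^ m a i)) fun i _ => by
        rw [map_pow]
        exact degreeLE_mono 𝒜 (Nat.mul_le_mul_left _ (a i).2.le) (pow_mem_degreeLE 𝒜 (hc' i) _)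
    refine degreeLE_mono 𝒜 ?_ h2
    rw [Finset.card_univ, Fintype.card_fin]
    nlinarith
  have hli' : LinearIndependent k fun a : Fin s → Fin N =>
      (⟨_, hmem a⟩ : degreeLE 𝒜 ((C * s + 1) * N)) :=
    LinearIndependent.of_comp (degreeLE 𝒜 ((C * s + 1) * N)).subtype hli
  have h3 := hli'.fintype_card_le_finrank
  rwa [finrank_degreeLE, Fintype.card_fun, Fintype.card_fin, Fintype.card_fin] at h3

/-- The multiplicity is a positive multiple of the limit of `∑_{i ≤ N} dim Aᵢ / N ^ d`, which is
positive because the cumulative Hilbert function grows at least like `N ^ d`, `d = dim A`. -/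
theorem HasMultiplicity.pos [∀ n, FiniteDimensional k (𝒜 n)] [Nontrivial A]
    [Algebra.FiniteType k A] {e : ℤ} (h : HasMultiplicity 𝒜 e) : 0 < e := by
  obtain ⟨d, hd⟩ : ∃ d : ℕ, ringKrullDim A = d := ⟨h.choose, h.choose_spec.choose_spec.1⟩
  obtain ⟨c, hc0, hc⟩ := exists_pow_le_cumulativeHilbert 𝒜 hd
  have h1 := (h.tendsto hd).comp (tendsto_id.const_mul_atTop' hc0)
  have h2 : (1 / (c : ℝ) ^ d) ≤ (e : ℝ) / d.factorial := by
    refine ge_of_tendsto h1 ?_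
    filter_upwards [eventually_gt_atTop 0] with N hN
    have h3 : ((N : ℝ) ^ d) ≤ cumulativeHilbert 𝒜 (c * N) := by exact_mod_cast hc N
    have hc0' : (0 : ℝ) < c := by exact_mod_cast hc0
    have hN' : (0 : ℝ) < N := by exact_mod_cast hN
    simp only [Function.comp_apply, id_eq]
    rw [div_le_div_iff₀ (by positivity) (by positivity)]
    push_cast
    rw [mul_pow, one_mul, mul_comm]
    gcongr
  have h4 : (0 : ℝ) < (e : ℝ) / d.factorial := lt_of_lt_of_le (by positivity) h2
  have h5 : (0 : ℝ) < e := by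
    have hfac : (0 : ℝ) < d.factorial := by positivity
    exact (div_pos_iff_of_pos_right hfac).1 h4
  exact_mod_cast h5

end Growth

/-! ### Finiteness of graded pieces -/

section Finiteness

variable {k : Type v} {A : Type u} [Field k] [CommRing A] [Algebra k A]
variable (𝒜 : ℕ → Submodule k A) [GradedAlgebra 𝒜]

/-- The ideal generated by `Aₙ` is finitely generated by elements of `Aₙ`; comparing components of
degree `n`, these generators span `Aₙ` over `A₀ = k`. -/
theorem finiteDimensional_of_gradeZero_eq_one [IsNoetherianRing A] (h0 : 𝒜 0 = 1) (n : ℕ) :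
    FiniteDimensional k (𝒜 n) := by
  obtain ⟨s, hs, hspan⟩ := (Submodule.fg_span_iff_fg_span_finset_subset (𝒜 n : Set A)).1
    (IsNoetherian.noetherian (Ideal.span (𝒜 n : Set A)))
  have hle : 𝒜 n ≤ Submodule.span k (s : Set A) := by
    intro x hx
    have hx' : x ∈ Submodule.span A (s : Set A) := hspan ▸ Submodule.subset_span hx
    obtain ⟨f, -, rfl⟩ := Submodule.mem_span_finset.1 hx'
    rw [← DirectSum.decompose_of_mem_same 𝒜 hx, DirectSum.decompose_sum,
      DFinsupp.finsetSum_apply, AddSubmonoidClass.coe_finsetSum]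
    refine sum_mem fun y hy => ?_
    have h1 := DirectSum.coe_decompose_mul_add_of_right_mem 𝒜 (a := f y) (i := 0) (hs hy)
    rw [zero_add] at h1
    rw [smul_eq_mul, h1]
    have h2 : (DirectSum.decompose 𝒜 (f y) 0 : A) ∈ (1 : Submodule k A) :=
      h0 ▸ (DirectSum.decompose 𝒜 (f y) 0).2
    obtain ⟨c, hc⟩ := Submodule.mem_one.1 h2
    rw [← hc, ← Algebra.smul_def]
    exact Submodule.smul_mem _ _ (Submodule.subset_span hy)
  have : FiniteDimensional k (Submodule.span k (s : Set A)) :=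
    FiniteDimensional.span_finset k s
  exact Submodule.finiteDimensional_of_le hle

end Finiteness

/-! ### Ring homomorphisms that are generically surjective -/

section GenericallySurjective

/-- Every `b : B` has a denominator in `A`: some nonzero `a : A` with `φ a * b` in the image of
`φ`. For an injective homomorphism of domains this says that the induced map of fraction fields is
bijective; the formulation avoids choosing fraction fields. -/
def GenericallySurjective {A B : Type*} [CommRing A] [CommRing B] (φ : A →+* B) : Prop :=
  ∀ b : B, ∃ a : A, a ≠ 0 ∧ φ a * b ∈ φ.range

theorem GenericallySurjective.exists_common_denominator {A B : Type*} [CommRing A] [IsDomain A]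
    [CommRing B] [Algebra A B] [Module.Finite A B]
    (h : GenericallySurjective (algebraMap A B)) :
    ∃ a : A, a ≠ 0 ∧ ∀ b : B, algebraMap A B a * b ∈ (algebraMap A B).range := by
  classical
  obtain ⟨t, ht⟩ := Module.Finite.fg_top (R := A) (M := B)
  choose s hs0 hs using h
  refine ⟨∏ b ∈ t, s b, Finset.prod_ne_zero_iff.2 fun b _ => hs0 b, fun b => ?_⟩
  have hb : b ∈ Submodule.span A (t : Set B) := ht ▸ Submodule.mem_top
  induction hb using Submodule.span_induction with
  | mem b hb =>
    rw [← Finset.prod_erase_mul _ _ hb, map_mul, mul_assoc]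
    exact mul_mem ⟨_, rfl⟩ (hs b)
  | zero => simp
  | add x y _ _ hx hy =>
    rw [mul_add]
    exact add_mem hx hy
  | smul c x _ hx =>
    rw [Algebra.smul_def, mul_left_comm]
    exact mul_mem ⟨_, rfl⟩ hx

theorem linearIndependent_pair_of_not_denominator {A B : Type*} [CommRing A] [CommRing B]
    [Algebra A B] (hinj : Function.Injective (algebraMap A B))
    {b : B} (hb : ∀ a : A, a ≠ 0 → algebraMap A B a * b ∉ (algebraMap A B).range) (x y : A)
    (h : algebraMap A B x + algebraMap A B y * b = 0) : x = 0 ∧ y = 0 := by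
  have hy : y = 0 := by
    by_contra hy
    exact hb y hy ⟨-x, by rw [map_neg]; linear_combination -h⟩
  refine ⟨?_, hy⟩
  rw [hy, map_zero, zero_mul, add_zero] at h
  exact hinj (h.trans (map_zero _).symm)

variable {A B : Type u} [CommRing A] [IsDomain A] [CommRing B] [Algebra A B]

theorem rankOverDomain_eq_rank : rankOverDomain A B = Module.rank A B := by
  have : IsLocalizedModule (nonZeroDivisors A) (TensorProduct.mk A (FractionRing A) B 1) :=
    (isLocalizedModule_iff_isBaseChange (nonZeroDivisors A) (FractionRing A) _).2
      (TensorProduct.isBaseChange A B (FractionRing A))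
  rw [rankOverDomain, IsLocalization.rank_eq (FractionRing A) (nonZeroDivisors A) le_rfl,
    IsLocalizedModule.rank_eq (nonZeroDivisors A) le_rfl (TensorProduct.mk A (FractionRing A) B 1)]

variable [IsDomain B]

theorem rank_eq_one_iff_genericallySurjective (hinj : Function.Injective (algebraMap A B)) :
    Module.rank A B = 1 ↔ GenericallySurjective (algebraMap A B) := by
  constructor
  · intro h b
    by_contra! hb
    have hli : LinearIndependent A ![(1 : B), b] := by
      rw [LinearIndependent.pair_iff]
      intro x y hxy
      rw [Algebra.smul_def, mul_one, Algebra.smul_def] at hxy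
      exact linearIndependent_pair_of_not_denominator hinj hb x y hxy
    have h2 := hli.cardinal_lift_le_rank
    rw [h] at h2
    norm_num at h2
  · intro h
    apply le_antisymm
    · have := rank_le (R := A) (M := B) (n := 1) fun s hs => by
        rw [Finset.card_le_one]
        intro x hx y hy
        by_contra hne
        obtain ⟨a, ha, a', ha'⟩ := h x
        obtain ⟨c, hc, c', hc'⟩ := h y
        have hpair := hs.comp ![⟨x, hx⟩, ⟨y, hy⟩] (by
          intro i j hij
          fin_cases i <;> fin_cases j <;> simp_all [eq_comm])
        have hpair' : LinearIndependent A ![x, y] := by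
          convert hpair using 1
          funext i
          fin_cases i <;> rfl
        rw [LinearIndependent.pair_iff] at hpair'
        have hx0 : x ≠ 0 := by
          rintro rfl
          exact one_ne_zero (hpair' 1 0 (by simp)).1
        have hrel : (c' * a) • x + (-(a' * c)) • y = 0 := by
          rw [Algebra.smul_def, Algebra.smul_def, map_neg, map_mul, map_mul, ha', hc']
          ring
        have h1 := hpair' _ _ hrel
        have ha0 : a' ≠ 0 := by
          rintro rfl
          rw [map_zero, eq_comm, mul_eq_zero] at ha'
          rcases ha' with ha' | ha'
          · exact ha (hinj (ha'.trans (map_zero _).symm))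
          · exact hx0 ha'
        exact mul_ne_zero ha0 hc (neg_eq_zero.1 h1.2)
      exact_mod_cast this
    · have : FaithfulSMul A B := (faithfulSMul_iff_algebraMap_injective A B).2 hinj
      have hli : LinearIndependent A fun _ : Unit => (1 : B) := by
        rw [linearIndependent_unique_iff]
        exact one_ne_zero' B
      simpa using hli.cardinal_lift_le_rank

theorem rankOverDomain_eq_one_iff (hinj : Function.Injective (algebraMap A B)) :
    rankOverDomain A B = 1 ↔ GenericallySurjective (algebraMap A B) := by
  rw [rankOverDomain_eq_rank, rank_eq_one_iff_genericallySurjective hinj]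

theorem fractionInclusion_bijective_iff {k : Type v} [Field k] [Algebra k B]
    (S : Subalgebra k B) :
    Function.Bijective (fractionInclusion S) ↔ GenericallySurjective (algebraMap S B) := by
  have hmap : ∀ x : S, fractionInclusion S (algebraMap S (FractionRing S) x) =
      algebraMap B (FractionRing B) (algebraMap S B x) := fun x => IsLocalization.map_eq
      (nonZeroDivisors_le_comap_nonZeroDivisors_of_injective _ Subtype.val_injective) x
  have hB := IsFractionRing.injective B (FractionRing B)
  constructor
  · intro h b
    obtain ⟨z, hz⟩ := h.2 (algebraMap B (FractionRing B) b)
    obtain ⟨x, y, hy, rfl⟩ := IsFractionRing.div_surjective (A := S) z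
    have hy0 : y ≠ 0 := nonZeroDivisors.ne_zero hy
    refine ⟨y, hy0, x, hB ?_⟩
    have hy1 : algebraMap B (FractionRing B) (algebraMap S B y) ≠ 0 := fun h0 =>
      hy0 (Subtype.val_injective (hB (h0.trans (map_zero _).symm)))
    rw [map_div₀, hmap, hmap, div_eq_iff hy1] at hz
    rw [map_mul, hz, mul_comm]
  · intro h
    refine ⟨RingHom.injective _, ?_⟩
    have hr : ∀ b : B, algebraMap B (FractionRing B) b ∈ (fractionInclusion S).fieldRange := by
      intro b
      obtain ⟨s, hs, x, hx⟩ := h b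
      refine ⟨algebraMap S _ x / algebraMap S _ s, ?_⟩
      have hs1 : algebraMap B (FractionRing B) (algebraMap S B s) ≠ 0 := fun h0 =>
        hs (Subtype.val_injective (hB (h0.trans (map_zero _).symm)))
      rw [map_div₀, hmap, hmap, div_eq_iff hs1, hx, map_mul, mul_comm]
    intro z
    obtain ⟨x, y, -, rfl⟩ := IsFractionRing.div_surjective (A := B) z
    exact div_mem (hr x) (hr y)

end GenericallySurjective

/-! ### The graded subalgebra generated in degree one -/

section DegOne

variable {k : Type v} {R : Type u} [Field k] [CommRing R] [Algebra k R]
variable {𝒜 : ℕ → Submodule k R}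

theorem degOneGrading_zero (h0 : 𝒜 0 = 1) : degOneGrading 𝒜 0 = 1 := by
  ext x
  rw [mem_degOneGrading, h0, Submodule.mem_one, Submodule.mem_one]
  exact exists_congr fun c => ⟨fun h => Subtype.ext h, fun h => congrArg Subtype.val h⟩

theorem degOne_degOneGrading : degOne (degOneGrading 𝒜) = ⊤ :=
  Algebra.adjoin_adjoin_coe_preimage

/-- `k[R₁]` is itself semistandard, so results on semistandard algebras apply to it. -/
theorem isSemistandard_degOneGrading : IsSemistandard (degOneGrading 𝒜) :=
  ⟨fun x => isIntegral_algebraMap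
    (x := (⟨x, degOne_degOneGrading (𝒜 := 𝒜) ▸ Algebra.mem_top⟩ : degOne (degOneGrading 𝒜)))⟩

theorem finiteType_degOne [FiniteDimensional k (𝒜 1)] : Algebra.FiniteType k (degOne 𝒜) := by
  obtain ⟨s, hs⟩ := (Submodule.fg_iff_finiteDimensional (𝒜 1)).2 inferInstance
  rw [degOne, ← hs, Algebra.adjoin_span]
  exact (Subalgebra.fg_iff_finiteType _).1 (Subalgebra.fg_adjoin_finset s)

theorem IsSemistandard.module_finite [Algebra.FiniteType k R] (hs : IsSemistandard 𝒜) :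
    Module.Finite (degOne 𝒜) R := by
  have : Algebra.IsIntegral (degOne 𝒜) R := hs
  have : Algebra.FiniteType (degOne 𝒜) R := Algebra.FiniteType.of_restrictScalars_finiteType k _ _
  exact Algebra.IsIntegral.finite

variable (𝒜) [GradedAlgebra 𝒜]

theorem coe_decompose_degOneGrading (x : degOne 𝒜) (n : ℕ) :
    ((DirectSum.decompose (degOneGrading 𝒜) x n : degOne 𝒜) : R) =
      DirectSum.decompose 𝒜 (x : R) n := by
  rw [← decompose_coe_degOne]
  congr 4
  exact (DirectSum.decompose (degOneGrading 𝒜)).symm_apply_apply x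

theorem mem_degreeLE_degOneGrading {x : degOne 𝒜} {N : ℕ} :
    x ∈ degreeLE (degOneGrading 𝒜) N ↔ (x : R) ∈ degreeLE 𝒜 N := by
  simp only [mem_degreeLE, ← coe_decompose_degOneGrading, ZeroMemClass.coe_eq_zero]

variable {𝒜}

/-- A homogeneous prime containing `R₁` is the irrelevant ideal: `R` is integral over
`k[R₁]`, so no relevant prime can contract to the irrelevant ideal of `k[R₁]`. -/
theorem IsSemistandard.mem_of_isPrime (h0 : 𝒜 0 = 1) (hs : IsSemistandard 𝒜) (P : Ideal R)
    (hP : P.IsPrime) (hPh : P.IsHomogeneous 𝒜) (h1 : ∀ x ∈ 𝒜 1, x ∈ P) :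
    ∀ n, 0 < n → ∀ x ∈ 𝒜 n, x ∈ P := by
  by_contra! hcon
  obtain ⟨n, hn, x, hx, hxP⟩ := hcon
  let p : Proj 𝒜 := ⟨⟨P, hPh⟩, hP,
    fun h => hxP (h (HomogeneousIdeal.mem_irrelevant_of_mem 𝒜 hn hx))⟩
  obtain ⟨⟨⟨m, hm⟩, s, hsm⟩, hps⟩ := hs.pullsBackRelevant h0 p
  rw [Proj.mem_basicOpen] at hps
  refine hps ?_
  change (s : R) ∈ P
  -- Modulo `P`, the algebra generated by `R₁` reduces to constants, and `s` has no constant term.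
  have hconst : ∀ y ∈ degOne 𝒜, ∃ c : k, y - algebraMap k R c ∈ P := by
    intro y hy
    induction hy using Algebra.adjoin_induction with
    | mem y hy => exact ⟨0, by simpa using h1 y hy⟩
    | algebraMap c => exact ⟨c, by simp⟩
    | add y z _ _ hy hz =>
      obtain ⟨c, hc⟩ := hy
      obtain ⟨d, hd⟩ := hz
      refine ⟨c + d, ?_⟩
      rw [map_add, add_sub_add_comm]
      exact P.add_mem hc hd
    | mul y z _ _ hy hz =>
      obtain ⟨c, hc⟩ := hy
      obtain ⟨d, hd⟩ := hz
      refine ⟨c * d, ?_⟩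
      have : y * z - algebraMap k R (c * d) =
          z * (y - algebraMap k R c) + algebraMap k R c * (z - algebraMap k R d) := by
        rw [map_mul]
        ring
      rw [this]
      exact P.add_mem (P.mul_mem_left _ hc) (P.mul_mem_left _ hd)
  obtain ⟨c, hc⟩ := hconst s s.2
  have h2 := hPh 0 hc
  rw [DirectSum.decompose_sub, DirectSum.sub_apply, AddSubgroupClass.coe_sub,
    DirectSum.decompose_of_mem_ne 𝒜 ((mem_degOneGrading 𝒜).1 hsm) hm.ne',
    DirectSum.decompose_of_mem_same 𝒜 (SetLike.algebraMap_mem_graded 𝒜 c), zero_sub,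
    neg_mem_iff] at h2
  simpa using P.add_mem hc h2

theorem IsSemistandard.exists_hasMultiplicity [Nontrivial R] [Algebra.FiniteType k R]
    (h0 : 𝒜 0 = 1) (hs : IsSemistandard 𝒜) : ∃ e : ℤ, HasMultiplicity 𝒜 e := by
  have : IsNoetherianRing R := Algebra.FiniteType.isNoetherianRing k R
  have := finiteDimensional_of_gradeZero_eq_one 𝒜 h0
  obtain ⟨d, hd⟩ := exists_natCast_eq_ringKrullDim k R
  have hd' : ringKrullDim (R ⧸ (⊥ : Ideal R)) ≤ d :=
    (ringKrullDim_le_of_surjective (RingEquiv.quotientBot R).symm.toRingHom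
      (RingEquiv.quotientBot R).symm.surjective).trans hd.le
  obtain ⟨Q, hQ⟩ := quotientHilbertSeries_mul_mem 𝒜 (hs.mem_of_isPrime h0) ⊥
    (Ideal.IsHomogeneous.bot 𝒜) d hd'
  rw [quotientHilbertSeries_bot] at hQ
  exact ⟨Q.eval 1, d, Q, hd, hQ.symm, rfl⟩

variable [∀ n, FiniteDimensional k (𝒜 n)]

instance finiteDimensional_degOneGrading (n : ℕ) : FiniteDimensional k (degOneGrading 𝒜 n) :=
  FiniteDimensional.of_injective
    (((degOne 𝒜).val.toLinearMap.comp (degOneGrading 𝒜 n).subtype).codRestrict (𝒜 n)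
      fun x => x.2) fun _ _ h => by
      have h1 := congrArg Subtype.val h
      exact Subtype.ext (Subtype.ext h1)

theorem cumulativeHilbert_degOneGrading_le (N : ℕ) :
    cumulativeHilbert (degOneGrading 𝒜) N ≤ cumulativeHilbert 𝒜 N := by
  have := finiteDimensional_degreeLE 𝒜 N
  rw [← finrank_degreeLE, ← finrank_degreeLE]
  refine LinearMap.finrank_le_finrank_of_injective
    (f := ((degOne 𝒜).val.toLinearMap.comp (degreeLE (degOneGrading 𝒜) N).subtype).codRestrict
      (degreeLE 𝒜 N) fun x => (mem_degreeLE_degOneGrading 𝒜).1 x.2) ?_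
  exact fun _ _ h => by
      have h1 := congrArg Subtype.val h
      exact Subtype.ext (Subtype.ext h1)

/-- Multiplication by `s` embeds `R` into `k[R₁]` and raises degrees by at most `a`. -/
theorem cumulativeHilbert_le_of_denominator [IsDomain R] {s : degOne 𝒜} (hs0 : s ≠ 0)
    (hs : ∀ r : R, (s : R) * r ∈ degOne 𝒜) {a : ℕ} (ha : (s : R) ∈ degreeLE 𝒜 a) (N : ℕ) :
    cumulativeHilbert 𝒜 N ≤ cumulativeHilbert (degOneGrading 𝒜) (N + a) := by
  have := finiteDimensional_degreeLE (degOneGrading 𝒜) (N + a)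
  rw [← finrank_degreeLE, ← finrank_degreeLE]
  let f : R →ₗ[k] degOne 𝒜 :=
    (LinearMap.mulLeft k (s : R)).codRestrict (Subalgebra.toSubmodule (degOne 𝒜)) hs
  refine LinearMap.finrank_le_finrank_of_injective
    (f := (f.comp (degreeLE 𝒜 N).subtype).codRestrict (degreeLE (degOneGrading 𝒜) (N + a))
      fun x => (mem_degreeLE_degOneGrading 𝒜).2 (by
        rw [add_comm]
        exact mul_mem_degreeLE 𝒜 ha x.2)) ?_
  intro x y h
  have h1 : (s : R) * x = s * y :=
    congrArg (fun z : degreeLE (degOneGrading 𝒜) (N + a) => ((z : degOne 𝒜) : R)) h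
  exact Subtype.ext (mul_left_cancel₀ (fun h => hs0 (Subtype.ext h)) h1)

/-- If `r` has no denominator in `k[R₁]`, then `1` and `r` are linearly independent over `k[R₁]`,
so `R` contains the direct sum of `k[R₁]` and `k[R₁] r`. -/
theorem two_mul_cumulativeHilbert_le [IsDomain R] {r : R}
    (hr : ∀ s : degOne 𝒜, s ≠ 0 → algebraMap (degOne 𝒜) R s * r ∉ (algebraMap (degOne 𝒜) R).range)
    {a : ℕ} (ha : r ∈ degreeLE 𝒜 a) (N : ℕ) :
    2 * cumulativeHilbert (degOneGrading 𝒜) N ≤ cumulativeHilbert 𝒜 (N + a) := by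
  have := finiteDimensional_degreeLE 𝒜 (N + a)
  have := finiteDimensional_degreeLE (degOneGrading 𝒜) N
  rw [← finrank_degreeLE, ← finrank_degreeLE, two_mul, ← Module.finrank_prod]
  let ι : degreeLE (degOneGrading 𝒜) N →ₗ[k] R :=
    (degOne 𝒜).val.toLinearMap.comp (degreeLE (degOneGrading 𝒜) N).subtype
  let f : (degreeLE (degOneGrading 𝒜) N × degreeLE (degOneGrading 𝒜) N) →ₗ[k] R :=
    ι.coprod ((LinearMap.mulRight k r).comp ι)
  have hf : ∀ x, f x = ((x.1 : degOne 𝒜) : R) + ((x.2 : degOne 𝒜) : R) * r := fun _ => rfl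
  have hι : ∀ x : degreeLE (degOneGrading 𝒜) N, ((x : degOne 𝒜) : R) ∈ degreeLE 𝒜 N := fun x =>
    (mem_degreeLE_degOneGrading 𝒜).1 x.2
  refine LinearMap.finrank_le_finrank_of_injective (f := f.codRestrict (degreeLE 𝒜 (N + a))
    fun x => ?_) ?_
  · rw [hf]
    exact add_mem (degreeLE_mono 𝒜 (by omega) (hι x.1)) (mul_mem_degreeLE 𝒜 (hι x.2) ha)
  · rw [← LinearMap.ker_eq_bot, LinearMap.ker_codRestrict, LinearMap.ker_eq_bot']
    rintro ⟨x, y⟩ hxy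
    obtain ⟨h1, h2⟩ := linearIndependent_pair_of_not_denominator
      (A := degOne 𝒜) Subtype.val_injective hr x y hxy
    exact Prod.ext (Subtype.ext h1) (Subtype.ext h2)

end DegOne

/-! ### Comparison of multiplicities -/

section VirtuallyStandard

open Filter Topology

variable {k : Type v} {R : Type u} [Field k] [CommRing R] [IsDomain R] [Algebra k R]
  [Algebra.FiniteType k R] {𝒜 : ℕ → Submodule k R} [GradedAlgebra 𝒜]

theorem isVirtuallyStandard_iff_genericallySurjective (h0 : 𝒜 0 = 1) (hs : IsSemistandard 𝒜) :
    IsVirtuallyStandard 𝒜 ↔ GenericallySurjective (algebraMap (degOne 𝒜) R) := by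
  have : IsNoetherianRing R := Algebra.FiniteType.isNoetherianRing k R
  have := finiteDimensional_of_gradeZero_eq_one 𝒜 h0
  have := finiteType_degOne (𝒜 := 𝒜)
  have : Algebra.IsIntegral (degOne 𝒜) R := hs
  obtain ⟨d, hd⟩ := exists_natCast_eq_ringKrullDim k R
  have hd' : ringKrullDim (degOne 𝒜) = d :=
    (ringKrullDim_eq_of_isIntegral (degOne 𝒜) R Subtype.val_injective).symm.trans hd
  have hfac : (0 : ℝ) < d.factorial := by positivity
  constructor
  · rintro ⟨-, e, heR, heS⟩ r
    by_contra! hr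
    obtain ⟨a, ha⟩ := exists_mem_degreeLE 𝒜 r
    have hle : 2 * ((e : ℝ) / d.factorial) ≤ (e : ℝ) / d.factorial := by
      refine le_of_tendsto_of_tendsto' ((heS.tendsto hd').const_mul 2)
        (heR.tendsto_shift hd a) fun N => ?_
      rw [← mul_div_assoc]
      gcongr
      exact_mod_cast two_mul_cumulativeHilbert_le hr ha N
    have hpos : (0 : ℝ) < (e : ℝ) / d.factorial :=
      div_pos (by exact_mod_cast heS.pos) hfac
    linarith
  · intro hg
    have := hs.module_finite
    obtain ⟨s, hs0, hsR⟩ := hg.exists_common_denominator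
    have hsR' : ∀ r : R, (s : R) * r ∈ degOne 𝒜 := fun r => by
      obtain ⟨x, hx⟩ := hsR r
      exact (show algebraMap (degOne 𝒜) R s * r ∈ degOne 𝒜 from hx ▸ x.2)
    obtain ⟨a, ha⟩ := exists_mem_degreeLE 𝒜 (s : R)
    obtain ⟨eR, heR⟩ := hs.exists_hasMultiplicity h0
    obtain ⟨eS, heS⟩ := (isSemistandard_degOneGrading (𝒜 := 𝒜)).exists_hasMultiplicity
      (degOneGrading_zero h0)
    have h1 : (eS : ℝ) / d.factorial ≤ (eR : ℝ) / d.factorial := by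
      refine le_of_tendsto_of_tendsto' (heS.tendsto hd') (heR.tendsto hd) fun N => ?_
      gcongr
      exact cumulativeHilbert_degOneGrading_le N
    have h2 : (eR : ℝ) / d.factorial ≤ (eS : ℝ) / d.factorial := by
      refine le_of_tendsto_of_tendsto' (heR.tendsto hd) (heS.tendsto_shift hd' a) fun N => ?_
      gcongr
      exact cumulativeHilbert_le_of_denominator hs0 hsR' ha N
    have h3 : (eR : ℝ) = eS := (div_left_inj' hfac.ne').1 (le_antisymm h2 h1)
    have h4 : eR = eS := by exact_mod_cast h3
    exact ⟨hs, eR, heR, h4 ▸ heS⟩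

end VirtuallyStandard

/-! ### Birational morphisms and affine charts -/

section Birational

/-- Birationality can be checked on dense open immersions `j` and `i` in place of dense open
subschemes. -/
theorem isBirational_of_isOpenImmersion {X Y Z Z' : Scheme.{u}} {f : X ⟶ Y} (j : Z ⟶ X)
    (i : Z' ⟶ Y) [IsOpenImmersion j] [IsOpenImmersion i] (hj : DenseRange j) (hi : DenseRange i)
    (g : Z ≅ Z') (h : j ≫ f = g.hom ≫ i) : IsBirational f := by
  refine ⟨⟨j.opensRange, hj, i.opensRange, hi,
    j.isoOpensRange.symm ≪≫ g ≪≫ i.isoOpensRange⟩, ?_⟩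
  rw [← cancel_epi j.isoOpensRange.hom]
  simp [← h]

theorem isBirational_of_isIso {X Y : Scheme.{u}} (f : X ⟶ Y) [IsIso f] : IsBirational f :=
  isBirational_of_isOpenImmersion (𝟙 X) (𝟙 Y) Function.surjective_id.denseRange
    Function.surjective_id.denseRange (asIso f) (by simp)

theorem isIso_stalkMap_of_mem_source {X Y : Scheme.{u}} {f : X ⟶ Y} {e : X.PartialIso Y}
    (h : e.iso.hom ≫ e.target.ι = e.source.ι ≫ f) {x : X} (hx : x ∈ e.source) :
    IsIso (f.stalkMap x) := by
  have h1 : IsOpenImmersion (e.source.ι ≫ f) := h ▸ inferInstance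
  let y : e.source.toScheme := ⟨x, hx⟩
  have h2 : IsIso ((e.source.ι ≫ f).stalkMap y) := inferInstance
  rw [Scheme.Hom.stalkMap_comp] at h2
  have h3 : IsIso (f.stalkMap (e.source.ι y) ≫ e.source.ι.stalkMap y) := h2
  exact IsIso.of_isIso_comp_right (f.stalkMap (e.source.ι y)) (e.source.ι.stalkMap y)

theorem isIso_stalkMap_of_comp_eq {X Y Z Z' : Scheme.{u}} {f : X ⟶ Y} {j : Z ⟶ X} {i : Z' ⟶ Y}
    {g : Z ⟶ Z'} [IsOpenImmersion j] [IsOpenImmersion i] (h : j ≫ f = g ≫ i) (x : Z)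
    [IsIso (f.stalkMap (j x))] : IsIso (g.stalkMap x) := by
  have h2 : IsIso ((j ≫ f).stalkMap x) := by
    rw [Scheme.Hom.stalkMap_comp]
    exact (inferInstance : IsIso (f.stalkMap (j x) ≫ j.stalkMap x))
  rw [h, Scheme.Hom.stalkMap_comp] at h2
  have h3 : IsIso (i.stalkMap (g x) ≫ g.stalkMap x) := h2
  exact IsIso.of_isIso_comp_left (i.stalkMap (g x)) (g.stalkMap x)

variable {A B : Type u} [CommRing A] [CommRing B] [IsDomain B]

theorem genericallySurjective_of_localRingHom_surjective {φ : A →+* B}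
    (h : Function.Surjective (Localization.localRingHom ((⊥ : Ideal B).comap φ) ⊥ φ rfl)) :
    GenericallySurjective φ := by
  intro b
  obtain ⟨z, hz⟩ := h (algebraMap B _ b)
  obtain ⟨a, s, rfl⟩ := IsLocalization.exists_mk'_eq ((⊥ : Ideal B).comap φ).primeCompl z
  have hs : φ s ≠ 0 := s.2
  refine ⟨s, fun h0 => hs (by rw [h0, map_zero]), a, ?_⟩
  rw [Localization.localRingHom_mk', IsLocalization.mk'_eq_iff_eq_mul, ← map_mul] at hz
  have hinj : Function.Injective (algebraMap B (Localization.AtPrime (⊥ : Ideal B))) :=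
    IsLocalization.injective _ (M := (⊥ : Ideal B).primeCompl) fun x hx =>
      mem_nonZeroDivisors_of_ne_zero hx
  rw [hinj hz, mul_comm]

/-- If `f` is birational and restricts to `Spec φ` between affine charts, with source the
spectrum of a domain, then comparing stalks at the generic point shows that `φ` is generically
surjective. -/
theorem IsBirational.genericallySurjective {X Y : Scheme.{u}} {f : X ⟶ Y} (hf : IsBirational f)
    (φ : A →+* B) (j : Spec (.of B) ⟶ X) (i : Spec (.of A) ⟶ Y)
    [IsOpenImmersion j] [IsOpenImmersion i] (h : j ≫ f = Spec.map (CommRingCat.ofHom φ) ≫ i) :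
    GenericallySurjective φ := by
  obtain ⟨e, he⟩ := hf
  let η : Spec (.of B) := (⊥ : PrimeSpectrum B)
  have hη : j η ∈ e.source := by
    obtain ⟨_, hx, y, rfl⟩ := e.dense_source.exists_mem_open j.opensRange.isOpen ⟨j η, η, rfl⟩
    have hsp : η ⤳ y :=
      (PrimeSpectrum.le_iff_specializes (⊥ : PrimeSpectrum B) y).1 bot_le
    exact hsp.mem_open (j ⁻¹ᵁ e.source).isOpen hx
  have h1 := isIso_stalkMap_of_mem_source he hη
  have h3 : IsIso ((Spec.map (CommRingCat.ofHom φ)).stalkMap η) := isIso_stalkMap_of_comp_eq h η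
  have h4 := ((MorphismProperty.isomorphisms CommRingCat).arrow_mk_iso_iff
    (Scheme.arrowStalkMapSpecIso (CommRingCat.ofHom φ) η)).1 h3
  exact genericallySurjective_of_localRingHom_surjective
    ((ConcreteCategory.isIso_iff_bijective _).1 h4).2

theorem denseRange_specMap_away [IsDomain A] {s : A} (hs : s ≠ 0) :
    DenseRange (Spec.map (CommRingCat.ofHom (algebraMap A (Localization.Away s)))) := by
  change DenseRange (PrimeSpectrum.comap (algebraMap A (Localization.Away s)))
  rw [PrimeSpectrum.denseRange_comap_iff_ker_le_nilRadical,
    (RingHom.injective_iff_ker_eq_bot _).1 (IsLocalization.injective (Localization.Away s)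
      (powers_le_nonZeroDivisors_of_noZeroDivisors hs))]
  exact bot_le

/-- If `f` restricts to `Spec φ` between dense affine charts and `φ` becomes an isomorphism after
inverting a common denominator, then `f` is birational. -/
theorem isBirational_of_common_denominator [IsDomain A] {X Y : Scheme.{u}} {f : X ⟶ Y}
    {φ : A →+* B} (hφ : Function.Injective φ)
    (j : Spec (.of B) ⟶ X) (i : Spec (.of A) ⟶ Y) [IsOpenImmersion j] [IsOpenImmersion i]
    (hj : DenseRange j) (hi : DenseRange i)
    (h : j ≫ f = Spec.map (CommRingCat.ofHom φ) ≫ i) {s : A} (hs0 : s ≠ 0)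
    (hs : ∀ b : B, φ s * b ∈ φ.range) : IsBirational f := by
  have hs0' : φ s ≠ 0 := (map_ne_zero_iff φ hφ).2 hs0
  have hbij : Function.Bijective (Localization.awayMap φ s) := by
    refine ⟨Localization.awayMap_injective_iff.2 fun a ha => ⟨0, ?_⟩,
      Localization.awayMap_surjective_iff.2 fun b => ?_⟩
    · rw [hφ (ha.trans (map_zero φ).symm), mul_zero]
    · obtain ⟨a, ha⟩ := hs b
      exact ⟨a, 1, by rw [pow_one, ha]⟩
  let ψ : CommRingCat.of (Localization.Away s) ≅ CommRingCat.of (Localization.Away (φ s)) :=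
    (RingEquiv.ofBijective (Localization.awayMap φ s) hbij).toCommRingCatIso
  have hcomm : CommRingCat.ofHom φ ≫ CommRingCat.ofHom (algebraMap B (Localization.Away (φ s))) =
      CommRingCat.ofHom (algebraMap A (Localization.Away s)) ≫ ψ.hom := by
    ext a
    simp [ψ, Localization.awayMap, IsLocalization.Away.map]
  refine isBirational_of_isOpenImmersion
    (Spec.map (CommRingCat.ofHom (algebraMap B (Localization.Away (φ s)))) ≫ j)
    (Spec.map (CommRingCat.ofHom (algebraMap A (Localization.Away s))) ≫ i) ?_ ?_
    (Scheme.Spec.mapIso ψ.op) ?_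
  · exact hj.comp (denseRange_specMap_away hs0') j.continuous
  · exact hi.comp (denseRange_specMap_away hs0) i.continuous
  · rw [Category.assoc, h]
    change _ = Spec.map ψ.hom ≫ _
    rw [← Spec.map_comp_assoc, ← Spec.map_comp_assoc, hcomm]

end Birational

/-! ### Charts of `Proj` -/

section Proj

variable {A σ : Type u} [CommRing A] [IsDomain A] [SetLike σ A] [AddSubgroupClass σ A]
  (𝒜 : ℕ → σ) [GradedRing 𝒜]

theorem denseRange_awayι {f : A} {m : ℕ} (hf : f ∈ 𝒜 m) (hm : 0 < m) (hf0 : f ≠ 0) :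
    DenseRange (Proj.awayι 𝒜 f hf hm) := by
  have hrange : Set.range (Proj.awayι 𝒜 f hf hm) = (Proj.basicOpen 𝒜 f : Set (Proj 𝒜)) :=
    congrArg (fun U : (Proj 𝒜).Opens => (U : Set (Proj 𝒜))) (Proj.opensRange_awayι 𝒜 f hf hm)
  rw [DenseRange, hrange]
  -- The zero ideal is a point of `Proj 𝒜` lying in every nonempty open subset.
  let η : Proj 𝒜 := ⟨⊥, by rw [HomogeneousIdeal.toIdeal_bot]; exact Ideal.isPrime_bot,
    fun h => hf0 (h (HomogeneousIdeal.mem_irrelevant_of_mem 𝒜 hm hf))⟩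
  have hη : ∀ g : A, g ≠ 0 → η ∈ Proj.basicOpen 𝒜 g := fun g hg h => hg h
  refine fun x => mem_closure_iff.2 fun U hU hxU => ⟨η, ?_, hη f hf0⟩
  obtain ⟨_, ⟨_, ⟨g, rfl⟩, rfl⟩, hxg, hgU⟩ :=
    (Proj.isBasis_basicOpen 𝒜).exists_subset_of_mem_open hxU hU
  refine hgU (hη g ?_)
  rintro rfl
  exact hxg (zero_mem _)

theorem isDomain_away {f : A} (hf0 : f ≠ 0) : IsDomain (Away 𝒜 f) := by
  have : IsDomain (Localization.Away f) :=
    IsLocalization.isDomain_localization (powers_le_nonZeroDivisors_of_noZeroDivisors hf0)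
  exact Function.Injective.isDomain (algebraMap (Away 𝒜 f) (Localization.Away f))
    (HomogeneousLocalization.val_injective _)

theorem away_mk_eq_zero_iff {f : A} {m : ℕ} (hf : f ∈ 𝒜 m) (hf0 : f ≠ 0) (n : ℕ) (x : A)
    (hx : x ∈ 𝒜 (n • m)) : Away.mk 𝒜 hf n x hx = 0 ↔ x = 0 := by
  rw [← (HomogeneousLocalization.val_injective _).eq_iff, HomogeneousLocalization.val_zero,
    Away.val_mk, Localization.mk_eq_mk', IsLocalization.mk'_eq_zero_iff]
  refine ⟨?_, fun h => ⟨1, by rw [h, mul_zero]⟩⟩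
  rintro ⟨⟨_, i, rfl⟩, h⟩
  exact (mul_eq_zero.1 h).resolve_left (pow_ne_zero i hf0)

end Proj

section ProjDegOne

variable {k : Type v} {R : Type u} [Field k] [CommRing R] [Algebra k R]
  {𝒜 : ℕ → Submodule k R}

theorem isBirational_specDegOne_iff [IsDomain R] [Algebra.FiniteType k R]
    (hs : IsSemistandard 𝒜) :
    IsBirational (specDegOne 𝒜) ↔ GenericallySurjective (algebraMap (degOne 𝒜) R) := by
  constructor
  · intro h
    exact h.genericallySurjective _ (𝟙 _) (𝟙 _) (by
      rw [Category.id_comp, Category.comp_id, specDegOne])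
  · intro h
    have := hs.module_finite
    obtain ⟨s, hs0, hsR⟩ := h.exists_common_denominator
    exact isBirational_of_common_denominator Subtype.val_injective (𝟙 _) (𝟙 _)
      Function.surjective_id.denseRange Function.surjective_id.denseRange
      (by rw [Category.id_comp, Category.comp_id, specDegOne]) hs0 hsR

variable [GradedAlgebra 𝒜]

/-- A common denominator can be chosen homogeneous, as every homogeneous component of a common
denominator is one. -/
theorem exists_homogeneous_of_denominator {s : degOne 𝒜} (hs0 : s ≠ 0)
    (hs : ∀ r : R, (s : R) * r ∈ degOne 𝒜) :
    ∃ (n : ℕ) (c : degOne 𝒜), c ∈ degOneGrading 𝒜 n ∧ c ≠ 0 ∧ ∀ r : R, (c : R) * r ∈ degOne 𝒜 := by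
  obtain ⟨n, hn⟩ : ∃ n, (DirectSum.decompose 𝒜 (s : R) n : R) ≠ 0 := by
    by_contra! h
    refine hs0 (Subtype.ext ?_)
    classical
    rw [← DirectSum.sum_support_decompose 𝒜 (s : R)]
    exact Finset.sum_eq_zero fun i _ => h i
  refine ⟨n, ⟨_, decompose_mem_degOne 𝒜 n s.2⟩, (DirectSum.decompose 𝒜 (s : R) n).2,
    fun h => hn (congrArg Subtype.val h), fun r => ?_⟩
  induction r using DirectSum.Decomposition.inductionOn 𝒜 with
  | zero => simp
  | @homogeneous m x =>
    have h := decompose_mem_degOne 𝒜 (n + m) (hs x)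
    rwa [DirectSum.coe_decompose_mul_add_of_right_mem 𝒜 x.2] at h
  | add x y hx hy =>
    rw [mul_add]
    exact add_mem hx hy

/-- A homogeneous common denominator `c` of degree `n` for `k[R₁] ⊆ R` gives the common denominator
`c / t ^ n` on the chart `D₊(t)`. -/
theorem away_map_mul_mem_range {t : degOne 𝒜} (ht : t ∈ degOneGrading 𝒜 1) {n : ℕ} {c : degOne 𝒜}
    (hc : c ∈ degOneGrading 𝒜 (n • 1)) (hcR : ∀ r : R, (c : R) * r ∈ degOne 𝒜)
    (b : Away 𝒜 (degOneIncl 𝒜 t)) :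
    Away.map (degOneIncl 𝒜) t (Away.mk _ ht n c hc) * b ∈ (Away.map (degOneIncl 𝒜) t).range := by
  obtain ⟨m, x, hx, rfl⟩ := Away.mk_surjective 𝒜 ((degOneIncl 𝒜).2 ht) b
  have hmem : (⟨(c : R) * x, hcR x⟩ : degOne 𝒜) ∈ degOneGrading 𝒜 ((n + m) • 1) := by
    rw [mem_degOneGrading, add_smul]
    exact SetLike.mul_mem_graded ((mem_degOneGrading 𝒜).1 hc) hx
  refine ⟨Away.mk _ ht (n + m) _ hmem, HomogeneousLocalization.val_injective _ ?_⟩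
  rw [Away.map_mk, Away.map_mk, HomogeneousLocalization.val_mul, Away.val_mk, Away.val_mk,
    Away.val_mk, Localization.mk_mul]
  congr 1
  exact Subtype.ext (pow_add _ _ _)

theorem IsSemistandard.isEmpty_proj (h0 : 𝒜 0 = 1) (hs : IsSemistandard 𝒜)
    (h1 : ∀ x ∈ 𝒜 1, x = 0) : IsEmpty (Proj 𝒜) := by
  refine ⟨fun p => p.not_irrelevant_le ((HomogeneousIdeal.irrelevant_le 𝒜).2 fun n hn x hx => ?_)⟩
  exact hs.mem_of_isPrime h0 p.asHomogeneousIdeal.toIdeal p.isPrime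
    p.asHomogeneousIdeal.isHomogeneous (fun y hy => h1 y hy ▸ zero_mem _) n hn x hx

variable [IsDomain R]

theorem injective_away_map {t : degOne 𝒜} (ht : t ∈ degOneGrading 𝒜 1) (ht0 : t ≠ 0) :
    Function.Injective (Away.map (degOneIncl 𝒜) t) := by
  rw [injective_iff_map_eq_zero]
  intro z hz
  obtain ⟨n, x, hx, rfl⟩ := Away.mk_surjective _ ht z
  have ht0' : degOneIncl 𝒜 t ≠ 0 := fun h => ht0 (Subtype.ext h)
  rw [Away.map_mk, away_mk_eq_zero_iff _ _ ht0'] at hz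
  rw [away_mk_eq_zero_iff _ _ ht0]
  exact Subtype.ext hz

/-- For `x` homogeneous of degree `n`, clearing powers of `t` in a denominator of `x / t ^ n` gives
a denominator of `x`. -/
theorem genericallySurjective_of_away_map {t : degOne 𝒜} (ht : t ∈ degOneGrading 𝒜 1)
    (ht0 : t ≠ 0) (h : GenericallySurjective (Away.map (degOneIncl 𝒜) t)) :
    GenericallySurjective (algebraMap (degOne 𝒜) R) := by
  have ht0' : (t : R) ≠ 0 := fun h => ht0 (Subtype.ext h)
  intro r
  induction r using DirectSum.Decomposition.inductionOn 𝒜 with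
  | zero => exact ⟨1, one_ne_zero, 0, by simp⟩
  | @homogeneous n x =>
    have hx : (x : R) ∈ 𝒜 (n • 1) := by
      rw [smul_eq_mul, mul_one]
      exact x.2
    obtain ⟨a, ha0, z, hz⟩ := h (Away.mk 𝒜 ((degOneIncl 𝒜).2 ht) n x hx)
    obtain ⟨m, c, hc, rfl⟩ := Away.mk_surjective _ ht a
    obtain ⟨l, d, hd, rfl⟩ := Away.mk_surjective _ ht z
    rw [Ne, away_mk_eq_zero_iff _ _ ht0] at ha0
    have h1 := congrArg HomogeneousLocalization.val hz
    rw [Away.map_mk, Away.map_mk, HomogeneousLocalization.val_mul, Away.val_mk, Away.val_mk,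
      Away.val_mk, Localization.mk_mul, Localization.mk_eq_mk_iff, Localization.r_iff_exists] at h1
    obtain ⟨⟨_, i, rfl⟩, h2⟩ := h1
    have h3 := mul_left_cancel₀ (pow_ne_zero i ht0') h2
    refine ⟨t ^ l * c, mul_ne_zero (pow_ne_zero l ht0) ha0, t ^ m * t ^ n * d, ?_⟩
    rw [map_mul, map_mul, map_mul, map_pow, map_pow, map_pow,
      mul_assoc (algebraMap (degOne 𝒜) R t ^ l)]
    exact h3
  | add x y hx hy =>
    obtain ⟨a, ha, a', ha'⟩ := hx
    obtain ⟨b, hb, b', hb'⟩ := hy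
    refine ⟨a * b, mul_ne_zero ha hb, b * a' + a * b', ?_⟩
    rw [map_add, map_mul, map_mul, map_mul, ha', hb']
    ring

/-- If `R₁ = 0`, then `R = R₀`. -/
theorem IsSemistandard.mem_degOne_of_degree_one_eq_zero (h0 : 𝒜 0 = 1) (hs : IsSemistandard 𝒜)
    (h1 : ∀ x ∈ 𝒜 1, x = 0) (r : R) : r ∈ degOne 𝒜 := by
  induction r using DirectSum.Decomposition.inductionOn 𝒜 with
  | zero => exact zero_mem _
  | @homogeneous n x =>
    rcases Nat.eq_zero_or_pos n with rfl | hn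
    · have hx : (x : R) ∈ (1 : Submodule k R) := h0 ▸ x.2
      obtain ⟨c, hc⟩ := Submodule.mem_one.1 hx
      rw [← hc]
      exact (degOne 𝒜).algebraMap_mem c
    · have hx := hs.mem_of_isPrime h0 ⊥ Ideal.isPrime_bot (Ideal.IsHomogeneous.bot 𝒜)
        (fun y hy => h1 y hy) n hn x x.2
      rw [Ideal.mem_bot] at hx
      rw [hx]
      exact zero_mem _
  | add x y hx hy => exact add_mem hx hy

variable [Algebra.FiniteType k R]

theorem GenericallySurjective.exists_homogeneous_denominator (hs : IsSemistandard 𝒜)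
    (hg : GenericallySurjective (algebraMap (degOne 𝒜) R)) :
    ∃ (n : ℕ) (c : degOne 𝒜), c ∈ degOneGrading 𝒜 n ∧ c ≠ 0 ∧ ∀ r : R, (c : R) * r ∈ degOne 𝒜 := by
  have := hs.module_finite
  obtain ⟨s, hs0, hsR⟩ := hg.exists_common_denominator
  refine exists_homogeneous_of_denominator hs0 fun r => ?_
  obtain ⟨x, hx⟩ := hsR r
  exact (show algebraMap (degOne 𝒜) R s * r ∈ degOne 𝒜 from hx ▸ x.2)

theorem isBirational_projDegOne_iff (h0 : 𝒜 0 = 1) (hs : IsSemistandard 𝒜) :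
    IsBirational (projDegOne h0 hs) ↔ GenericallySurjective (algebraMap (degOne 𝒜) R) := by
  by_cases h1 : ∀ x ∈ 𝒜 1, x = 0
  · -- A morphism to an empty scheme is an isomorphism.
    have hempty : IsEmpty (Proj (degOneGrading 𝒜)) :=
      isSemistandard_degOneGrading.isEmpty_proj (degOneGrading_zero h0)
        fun x hx => Subtype.ext (h1 _ ((mem_degOneGrading 𝒜).1 hx))
    exact iff_of_true (isBirational_of_isIso _) fun r => ⟨1, one_ne_zero,
      ⟨r, hs.mem_degOne_of_degree_one_eq_zero h0 h1 r⟩, by rw [map_one, one_mul]; rfl⟩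
  · push Not at h1
    obtain ⟨t, ht, ht0⟩ := h1
    let τ : degOne 𝒜 := ⟨t, Algebra.subset_adjoin ht⟩
    have hτ : τ ∈ degOneGrading 𝒜 1 := ht
    have hτ0 : τ ≠ 0 := fun h => ht0 (congrArg Subtype.val h)
    have := isDomain_away 𝒜 (f := degOneIncl 𝒜 τ) ht0
    have := isDomain_away (degOneGrading 𝒜) hτ0
    have hcomm := awayι_projMap (degOneIncl 𝒜) (hs.pullsBackRelevant h0) one_pos τ hτ
    constructor
    · intro h
      exact genericallySurjective_of_away_map hτ hτ0 (h.genericallySurjective _ _ _ hcomm)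
    · intro h
      obtain ⟨n, c, hc, hc0, hcR⟩ := h.exists_homogeneous_denominator hs
      have hc' : c ∈ degOneGrading 𝒜 (n • 1) := by rwa [smul_eq_mul, mul_one]
      exact isBirational_of_common_denominator (injective_away_map hτ hτ0) _ _
        (denseRange_awayι 𝒜 _ one_pos ht0) (denseRange_awayι _ hτ one_pos hτ0) hcomm
        (s := Away.mk _ hτ n c hc') (by rwa [Ne, away_mk_eq_zero_iff _ _ hτ0])
        (away_map_mul_mem_range hτ hc' hcR)

end ProjDegOne

end VirtStd

theorem mainTheorem7 {k : Type v} {R : Type u} [Field k] [CommRing R] [IsDomain R] [Algebra k R]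
    [Algebra.FiniteType k R] (𝒜 : ℕ → Submodule k R) [GradedAlgebra 𝒜]
    (h0 : 𝒜 0 = 1) (hs : IsSemistandard 𝒜) :
    List.TFAE [
      IsVirtuallyStandard 𝒜,
      rankOverDomain (degOne 𝒜) R = 1,
      Function.Bijective (fractionInclusion (degOne 𝒜)),
      IsBirational (specDegOne 𝒜),
      IsBirational (projDegOne h0 hs)] := by
  have ha := isVirtuallyStandard_iff_genericallySurjective h0 hs
  have hb := rankOverDomain_eq_one_iff (A := degOne 𝒜) (B := R) Subtype.val_injective
  have hc := fractionInclusion_bijective_iff (degOne 𝒜)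
  have hd := isBirational_specDegOne_iff hs
  have he := isBirational_projDegOne_iff h0 hs
  tfae_have 1 ↔ 2 := ha.trans hb.symm
  tfae_have 2 ↔ 3 := hb.trans hc.symm
  tfae_have 3 ↔ 4 := hc.trans hd.symm
  tfae_have 4 ↔ 5 := hd.trans he.symm
  tfae_finish
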